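/- Let $n>1$ be an integer and let $\omega\in\mathbb{C}$ be a root of unity of order exactly $n$. Let $H$ be the Radford algebra, i.e. the Hopf algebra over $\mathbb{C}$ generated as an algebra by $g,x,y$ subject to the relations $$g^n=1,\quad x^n=y^n=0,\quad xg=\omega gx,\quad gy=\omega yg,\quad xy=\omega yx,$$ with comultiplication $\Delta$, counit $\varepsilon$ and antipode $S$ given by $$\Delta(g)=g\otimes g,\quad \Delta(x)=x\otimes g+1\otimes x,\quad \Delta(y)=y\otimes g+1\otimes y,$$ $$\varepsilon(g)=1,\quad \varepsilon(x)=\varepsilon(y)=0,\quad S(g)=g^{n-1},\quad S(x)=-xg^{n-1},\quad S(y)=-yg^{n-1}.$$ A $*$-structure on $H$ is a conjugate-linear map $*:H\to H$ such that for all $h,l\in H$ $$(h^*)^*=h,\quad (hl)^*=l^*h^*,\quad \sum (h^*)_1\otimes (h^*)_2=\sum (h_1)^*\otimes (h_2)^*,\quad S(S(h^*)^*)=h.$$ (1) Suppose $n>2$. For all $\alpha,\beta\in\mathbb{C}$ with $|\alpha|=|\beta|=1$ there is exactly one $*$-structure on $H$ with $$g^*=g,\quad x^*=\alpha x,\quad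 y^*=\beta y,$$ and every $*$-structure on $H$ is of this form for exactly one such pair $(\alpha,\beta)$. (2) Suppose $n=2$. For every matrix $A=(\alpha_{ij})\in M_2(\mathbb{C})$ with $\overline{A}A=I_2$, where $\overline{A}$ is the entrywise complex conjugate of $A$, there is exactly one $*$-structure on $H$ with $$g^*=g,\quad x^*=\alpha_{11}x+\alpha_{12}y,\quad y^*=\alpha_{21}x+\alpha_{22}y,$$ and every $*$-structure on $H$ is of this form for exactly one such matrix $A$. -/

import Mathlib

open scoped TensorProduct

/-- The three generators of the Radford algebra. -/
inductive RadfordGen : Type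
  | g
  | x
  | y

namespace RadfordAlgebra

/-- The defining relations
`g^n = 1`, `x^n = y^n = 0`, `x g = ω g x`, `g y = ω y g`, `x y = ω y x`,
on the free algebra `ℂ⟨g, x, y⟩`. -/
inductive Rel (n : ℕ) (ω : ℂ) :
    FreeAlgebra ℂ RadfordGen → FreeAlgebra ℂ RadfordGen → Prop
  | g_pow : Rel n ω (FreeAlgebra.ι ℂ RadfordGen.g ^ n) 1
  | x_pow : Rel n ω (FreeAlgebra.ι ℂ RadfordGen.x ^ n) 0
  | y_pow : Rel n ω (FreeAlgebra.ι ℂ RadfordGen.y ^ n) 0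
  | x_g : Rel n ω (FreeAlgebra.ι ℂ RadfordGen.x * FreeAlgebra.ι ℂ RadfordGen.g)
      (ω • (FreeAlgebra.ι ℂ RadfordGen.g * FreeAlgebra.ι ℂ RadfordGen.x))
  | g_y : Rel n ω (FreeAlgebra.ι ℂ RadfordGen.g * FreeAlgebra.ι ℂ RadfordGen.y)
      (ω • (FreeAlgebra.ι ℂ RadfordGen.y * FreeAlgebra.ι ℂ RadfordGen.g))
  | x_y : Rel n ω (FreeAlgebra.ι ℂ RadfordGen.x * FreeAlgebra.ι ℂ RadfordGen.y)
      (ω • (FreeAlgebra.ι ℂ RadfordGen.y * FreeAlgebra.ι ℂ RadfordGen.x))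

end RadfordAlgebra

/-- The Radford algebra `H` over `ℂ`, for an integer `n > 1` and a root of unity `ω` of order `n`:
the `ℂ`-algebra with generators `g, x, y` and the relations `RadfordAlgebra.Rel n ω`. -/
def RadfordAlgebra {n : ℕ} {ω : ℂ} (_hn : 1 < n) (_hω : IsPrimitiveRoot ω n) : Type :=
  RingQuot (RadfordAlgebra.Rel n ω)

namespace RadfordAlgebra

section QBinomial

/-- The `q`-binomial coefficients, through Pascal's rule. -/
def qbinom (q : ℂ) : ℕ → ℕ → ℂ
  | _, 0 => 1
  | 0, _ + 1 => 0
  | m + 1, k + 1 => qbinom q m k + q ^ (k + 1) * qbinom q m (k + 1)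

theorem qbinom_zero_right (q : ℂ) (m : ℕ) : qbinom q m 0 = 1 := by
  cases m <;> rfl

theorem qbinom_succ_succ (q : ℂ) (m k : ℕ) :
    qbinom q (m + 1) (k + 1) = qbinom q m k + q ^ (k + 1) * qbinom q m (k + 1) := rfl

theorem qbinom_eq_zero (q : ℂ) (m k : ℕ) (h : m < k) : qbinom q m k = 0 := by
  induction m generalizing k with
  | zero => obtain ⟨k, rfl⟩ : ∃ j, k = j + 1 := ⟨k - 1, by omega⟩; rfl
  | succ m ih =>
    obtain ⟨k, rfl⟩ : ∃ j, k = j + 1 := ⟨k - 1, by omega⟩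
    rw [qbinom_succ_succ, ih k (by omega), ih (k + 1) (by omega)]; simp

theorem qbinom_self (q : ℂ) (m : ℕ) : qbinom q m m = 1 := by
  induction m with
  | zero => rfl
  | succ m ih => rw [qbinom_succ_succ, ih, qbinom_eq_zero q m (m + 1) (by omega)]; simp

theorem qbinom_step (q : ℂ) (k m : ℕ) :
    (q ^ (k + 1) - 1) * qbinom q (k + m) (k + 1) = (q ^ m - 1) * qbinom q (k + m) k := by
  suffices H : ∀ N k m, N = k + m →
      (q ^ (k + 1) - 1) * qbinom q N (k + 1) = (q ^ m - 1) * qbinom q N k from H _ k m rfl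
  intro N
  induction N with
  | zero =>
    intro k m h
    obtain rfl : m = 0 := by omega
    rw [qbinom_eq_zero q 0 (k + 1) (by omega)]; simp
  | succ N ih =>
    intro k m h
    rcases m with _ | m
    · rw [qbinom_eq_zero q (N + 1) (k + 1) (by omega)]; simp
    · rw [qbinom_succ_succ]
      have h1 := ih k m (by omega)
      rcases k with _ | k
      · simp only [qbinom_zero_right, pow_succ, pow_zero] at *
        linear_combination q * h1
      · have h2 := ih k (m + 1) (by omega)
        rw [qbinom_succ_succ]
        simp only [pow_succ] at *
        linear_combination q ^ k * q * q * h1 + h2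

variable {A : Type*} [Ring A] [Algebra ℂ A]

theorem mul_pow_of_qcomm {q : ℂ} {a b : A} (h : b * a = q • (a * b)) (k : ℕ) :
    b * a ^ k = q ^ k • (a ^ k * b) := by
  induction k with
  | zero => simp
  | succ k ih =>
    rw [pow_succ, ← mul_assoc, ih, smul_mul_assoc, mul_assoc, h, mul_smul_comm, smul_smul,
      ← mul_assoc, pow_succ]

theorem pow_mul_of_qcomm {q : ℂ} {a b : A} (h : b * a = q • (a * b)) (k : ℕ) :
    b ^ k * a = q ^ k • (a * b ^ k) := by
  induction k with
  | zero => simp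
  | succ k ih =>
    rw [pow_succ, mul_assoc, h, mul_smul_comm, ← mul_assoc, ih, smul_mul_assoc, smul_smul,
      mul_assoc, pow_succ, mul_comm]

theorem mul_pow_eq_zero_of_qcomm {q : ℂ} {a b : A} (h : b * a = q • (a * b)) {k : ℕ}
    (ha : a ^ k = 0) : (a * b) ^ k = 0 := by
  have H : ∀ m, ∃ c : ℂ, (a * b) ^ m = c • (a ^ m * b ^ m) := by
    intro m
    induction m with
    | zero => exact ⟨1, by simp⟩
    | succ m ih =>
      obtain ⟨c, hc⟩ := ih
      refine ⟨c * q ^ m, ?_⟩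
      calc (a * b) ^ (m + 1) = c • (a ^ m * (b ^ m * a) * b) := by
            rw [pow_succ, hc, smul_mul_assoc]; simp only [mul_assoc]
        _ = _ := by
            rw [pow_mul_of_qcomm h, mul_smul_comm, smul_mul_assoc, smul_smul, pow_succ a,
              pow_succ b]
            simp only [mul_assoc]
  obtain ⟨c, hc⟩ := H k
  rw [hc, ha, zero_mul, smul_zero]

theorem add_pow_of_qcomm {q : ℂ} {a b : A} (h : b * a = q • (a * b)) (m : ℕ) :
    (a + b) ^ m = ∑ k ∈ Finset.range (m + 1), qbinom q m k • (a ^ k * b ^ (m - k)) := by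
  induction m with
  | zero => simp [qbinom]
  | succ m ih =>
    have hb : b * ∑ k ∈ Finset.range (m + 1), qbinom q m k • (a ^ k * b ^ (m - k)) =
        ∑ k ∈ Finset.range (m + 2), (q ^ k * qbinom q m k) • (a ^ k * b ^ (m + 1 - k)) := by
      rw [Finset.sum_range_succ _ (m + 1), qbinom_eq_zero q m (m + 1) (by omega), mul_zero,
        zero_smul, add_zero, Finset.mul_sum]
      refine Finset.sum_congr rfl fun k hk => ?_
      have hk' : m + 1 - k = (m - k) + 1 := by have := Finset.mem_range.1 hk; omega
      rw [mul_smul_comm, ← mul_assoc, mul_pow_of_qcomm h, smul_mul_assoc, smul_smul, mul_assoc,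
        hk', pow_succ', mul_comm]
    rw [pow_succ', ih, add_mul, hb, Finset.sum_range_succ' _ (m + 1), Finset.sum_range_succ' _ (m + 1),
      Finset.mul_sum, ← add_assoc, ← Finset.sum_add_distrib]
    congr 1
    · refine Finset.sum_congr rfl fun k _ => ?_
      rw [qbinom_succ_succ, add_smul, mul_smul_comm, ← mul_assoc, ← pow_succ',
        Nat.add_sub_add_right]
    · simp [qbinom_zero_right]

/-- If `b a = q a b` with `q` a primitive `n`-th root of unity, then `(a + b)^n = a^n + b^n`. -/
theorem add_pow_of_qcomm_primitive {n : ℕ} {q : ℂ} (hn : 1 < n) (hq : IsPrimitiveRoot q n)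
    {a b : A} (h : b * a = q • (a * b)) : (a + b) ^ n = a ^ n + b ^ n := by
  rw [add_pow_of_qcomm h, Finset.sum_range_succ, qbinom_self, Nat.sub_self, pow_zero, mul_one,
    one_smul, add_comm]
  congr 1
  rw [Finset.sum_eq_single 0]
  · simp [qbinom_zero_right]
  · intro k hk hk0
    have hkn := Finset.mem_range.1 hk
    have hz : qbinom q n k = 0 := by
      have hcoef : ∀ j, j < n → qbinom q n j ≠ 0 → j = 0 := by
        intro j
        rcases j with _ | j
        · intros; rfl
        · intro hj hne
          exfalso
          obtain ⟨N, rfl⟩ : ∃ N, n = N + 1 := ⟨n - 1, by omega⟩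
          obtain ⟨m, rfl⟩ : ∃ m, N = j + m := ⟨N - j, by omega⟩
          have h1 := qbinom_step q j m
          have h2 : (q ^ (j + 1) - 1) * qbinom q (j + m + 1) (j + 1) = 0 := by
            have h3 : q ^ (j + m + 1) = 1 := hq.pow_eq_one
            rw [qbinom_succ_succ]
            have h4 : q ^ (j + 1) * q ^ m = 1 := by rw [← h3]; ring
            linear_combination q ^ (j + 1) * h1 + qbinom q (j + m) j * h4
          rcases mul_eq_zero.1 h2 with h5 | h5
          · exact hq.pow_ne_one_of_pos_of_lt (by omega) hj (sub_eq_zero.1 h5)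
          · exact hne h5
      by_contra hne
      exact hk0 (hcoef k hkn hne)
    rw [hz, zero_smul]
  · intro h0; exact absurd (Finset.mem_range.2 (by omega)) h0

end QBinomial

variable {n : ℕ} {ω : ℂ} {hn : 1 < n} {hω : IsPrimitiveRoot ω n}

noncomputable instance : Ring (RadfordAlgebra hn hω) :=
  inferInstanceAs (Ring (RingQuot (Rel n ω)))

noncomputable instance instAlgebra : Algebra ℂ (RadfordAlgebra hn hω) :=
  inferInstanceAs (Algebra ℂ (RingQuot (Rel n ω)))

/-- The quotient map `ℂ⟨g, x, y⟩ → H`. -/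
noncomputable def mk (hn : 1 < n) (hω : IsPrimitiveRoot ω n) :
    FreeAlgebra ℂ RadfordGen →ₐ[ℂ] RadfordAlgebra hn hω :=
  RingQuot.mkAlgHom ℂ (Rel n ω)

/-- The generator `g` of the Radford algebra. -/
noncomputable def g (hn : 1 < n) (hω : IsPrimitiveRoot ω n) : RadfordAlgebra hn hω :=
  mk hn hω (FreeAlgebra.ι ℂ RadfordGen.g)

/-- The generator `x` of the Radford algebra. -/
noncomputable def x (hn : 1 < n) (hω : IsPrimitiveRoot ω n) : RadfordAlgebra hn hω :=
  mk hn hω (FreeAlgebra.ι ℂ RadfordGen.x)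

/-- The generator `y` of the Radford algebra. -/
noncomputable def y (hn : 1 < n) (hω : IsPrimitiveRoot ω n) : RadfordAlgebra hn hω :=
  mk hn hω (FreeAlgebra.ι ℂ RadfordGen.y)

theorem mk_rel {a b : FreeAlgebra ℂ RadfordGen} (h : Rel n ω a b) : mk hn hω a = mk hn hω b :=
  RingQuot.mkAlgHom_rel ℂ h

theorem g_pow : g hn hω ^ n = 1 := by
  simpa [g] using mk_rel (hn := hn) (hω := hω) Rel.g_pow

theorem x_pow : x hn hω ^ n = 0 := by
  simpa [x] using mk_rel (hn := hn) (hω := hω) Rel.x_pow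

theorem y_pow : y hn hω ^ n = 0 := by
  simpa [y] using mk_rel (hn := hn) (hω := hω) Rel.y_pow

theorem x_mul_g : x hn hω * g hn hω = ω • (g hn hω * x hn hω) := by
  simpa [x, g] using mk_rel (hn := hn) (hω := hω) Rel.x_g

theorem g_mul_y : g hn hω * y hn hω = ω • (y hn hω * g hn hω) := by
  simpa [y, g] using mk_rel (hn := hn) (hω := hω) Rel.g_y

theorem x_mul_y : x hn hω * y hn hω = ω • (y hn hω * x hn hω) := by
  simpa [x, y] using mk_rel (hn := hn) (hω := hω) Rel.x_y

/-- Every element of `H` is a noncommutative polynomial in `g, x, y`. -/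
theorem induction {P : RadfordAlgebra hn hω → Prop}
    (halg : ∀ c : ℂ, P (algebraMap ℂ _ c)) (hg : P (g hn hω)) (hx : P (x hn hω))
    (hy : P (y hn hω)) (hmul : ∀ a b, P a → P b → P (a * b))
    (hadd : ∀ a b, P a → P b → P (a + b)) (h : RadfordAlgebra hn hω) : P h := by
  obtain ⟨f, rfl⟩ : ∃ f, mk hn hω f = h := RingQuot.mkAlgHom_surjective ℂ (Rel n ω) h
  induction f using FreeAlgebra.induction with
  | grade0 c => rw [AlgHom.commutes]; exact halg c
  | grade1 i => cases i <;> assumption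
  | mul a b ha hb => rw [map_mul]; exact hmul _ _ ha hb
  | add a b ha hb => rw [map_add]; exact hadd _ _ ha hb

/-- Algebra maps out of `H` agree if they agree on `g, x, y`. -/
theorem algHom_ext {B : Type*} [Semiring B] [Algebra ℂ B] {φ ψ : RadfordAlgebra hn hω →ₐ[ℂ] B}
    (hg : φ (g hn hω) = ψ (g hn hω)) (hx : φ (x hn hω) = ψ (x hn hω))
    (hy : φ (y hn hω) = ψ (y hn hω)) : φ = ψ := by
  ext h
  induction h using RadfordAlgebra.induction with
  | halg c => simp only [AlgHom.commutes]
  | hg => exact hg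
  | hx => exact hx
  | hy => exact hy
  | hmul a b ha hb => rw [map_mul, map_mul, ha, hb]
  | hadd a b ha hb => rw [map_add, map_add, ha, hb]

variable (hn hω) in
/-- The universal property of the presentation: elements `a, b, c` of a `ℂ`-algebra that satisfy
the relations of `g, x, y` determine an algebra map out of `H`. -/
noncomputable def lift {B : Type*} [Ring B] [Algebra ℂ B]
    (a b c : B) (h1 : a ^ n = 1) (h2 : b ^ n = 0) (h3 : c ^ n = 0) (h4 : b * a = ω • (a * b))
    (h5 : a * c = ω • (c * a)) (h6 : b * c = ω • (c * b)) : RadfordAlgebra hn hω →ₐ[ℂ] B :=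
  RingQuot.liftAlgHom ℂ ⟨FreeAlgebra.lift ℂ fun i => match i with
      | RadfordGen.g => a
      | RadfordGen.x => b
      | RadfordGen.y => c, by
    intro p q hpq
    cases hpq <;> simpa⟩

section lift

variable {B : Type*} [Ring B] [Algebra ℂ B] {a b c : B} {h1 : a ^ n = 1} {h2 : b ^ n = 0}
  {h3 : c ^ n = 0} {h4 : b * a = ω • (a * b)} {h5 : a * c = ω • (c * a)}
  {h6 : b * c = ω • (c * b)}

theorem lift_g : lift hn hω a b c h1 h2 h3 h4 h5 h6 (g hn hω) = a := by
  have := RingQuot.liftAlgHom_mkAlgHom_apply (S := ℂ) (s := Rel n ω) (B := B)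
  simp only [lift, g, mk]
  erw [this]
  simp

theorem lift_x : lift hn hω a b c h1 h2 h3 h4 h5 h6 (x hn hω) = b := by
  have := RingQuot.liftAlgHom_mkAlgHom_apply (S := ℂ) (s := Rel n ω) (B := B)
  simp only [lift, x, mk]
  erw [this]
  simp

theorem lift_y : lift hn hω a b c h1 h2 h3 h4 h5 h6 (y hn hω) = c := by
  have := RingQuot.liftAlgHom_mkAlgHom_apply (S := ℂ) (s := Rel n ω) (B := B)
  simp only [lift, y, mk]
  erw [this]
  simp

end lift

variable (hn hω) in
open Algebra.TensorProduct in
/-- The comultiplication: `Δ(g) = g ⊗ g`, `Δ(x) = x ⊗ g + 1 ⊗ x`, `Δ(y) = y ⊗ g + 1 ⊗ y`. -/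
noncomputable def comulHom :
    RadfordAlgebra hn hω →ₐ[ℂ] RadfordAlgebra hn hω ⊗[ℂ] RadfordAlgebra hn hω :=
  lift hn hω (g hn hω ⊗ₜ g hn hω) (x hn hω ⊗ₜ g hn hω + 1 ⊗ₜ x hn hω)
    (y hn hω ⊗ₜ g hn hω + 1 ⊗ₜ y hn hω)
    (by rw [tmul_pow, g_pow, one_def])
    (by
      rw [add_pow_of_qcomm_primitive hn hω, tmul_pow, tmul_pow, x_pow]
      · simp
      · simp [tmul_mul_tmul, x_mul_g])
    (by
      rw [add_comm, add_pow_of_qcomm_primitive hn hω, tmul_pow, tmul_pow, y_pow]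
      · simp
      · simp [tmul_mul_tmul, g_mul_y])
    (by
      simp only [add_mul, mul_add, tmul_mul_tmul, x_mul_g, one_mul, mul_one, smul_add,
        TensorProduct.smul_tmul', TensorProduct.tmul_smul])
    (by
      simp only [add_mul, mul_add, tmul_mul_tmul, g_mul_y, one_mul, mul_one, smul_add,
        TensorProduct.smul_tmul', TensorProduct.tmul_smul])
    (by
      simp only [add_mul, mul_add, tmul_mul_tmul, x_mul_g, g_mul_y, x_mul_y, one_mul, mul_one,
        smul_add, TensorProduct.smul_tmul', TensorProduct.tmul_smul]
      abel)

variable (hn hω) in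
/-- The counit: `ε(g) = 1`, `ε(x) = ε(y) = 0`. -/
noncomputable def counitHom :
    RadfordAlgebra hn hω →ₐ[ℂ] ℂ :=
  lift hn hω 1 0 0 (one_pow n) (zero_pow (by omega)) (zero_pow (by omega)) (by simp) (by simp)
    (by simp)

theorem g_mul_g_pow : g hn hω * g hn hω ^ (n - 1) = 1 := by
  rw [← pow_succ', Nat.sub_add_cancel hn.le, g_pow]

theorem g_pow_mul_g : g hn hω ^ (n - 1) * g hn hω = 1 := by
  rw [← pow_succ, Nat.sub_add_cancel hn.le, g_pow]

theorem g_pow_mul_x :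
    g hn hω ^ (n - 1) * x hn hω = ω • (x hn hω * g hn hω ^ (n - 1)) := by
  calc g hn hω ^ (n - 1) * x hn hω
      = g hn hω ^ (n - 1) * (x hn hω * g hn hω) * g hn hω ^ (n - 1) := by
        simp only [mul_assoc, g_mul_g_pow, mul_one]
    _ = _ := by
        rw [x_mul_g, mul_smul_comm, ← mul_assoc, g_pow_mul_g, one_mul, smul_mul_assoc]

theorem y_mul_g_pow :
    y hn hω * g hn hω ^ (n - 1) = ω • (g hn hω ^ (n - 1) * y hn hω) := by
  calc y hn hω * g hn hω ^ (n - 1)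
      = g hn hω ^ (n - 1) * (g hn hω * y hn hω) * g hn hω ^ (n - 1) := by
        rw [← mul_assoc, g_pow_mul_g, one_mul]
    _ = _ := by
        rw [g_mul_y, mul_smul_comm, smul_mul_assoc]
        simp only [mul_assoc, g_mul_g_pow, mul_one]

variable (hn hω) in
/-- The antipode, as an algebra map `H → Hᵒᵖ`:
`S(g) = g^(n-1)`, `S(x) = -x g^(n-1)`, `S(y) = -y g^(n-1)`. -/
noncomputable def antipodeHom :
    RadfordAlgebra hn hω →ₐ[ℂ] (RadfordAlgebra hn hω)ᵐᵒᵖ :=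
  lift hn hω (MulOpposite.op (g hn hω ^ (n - 1)))
    (MulOpposite.op (-(x hn hω * g hn hω ^ (n - 1))))
    (MulOpposite.op (-(y hn hω * g hn hω ^ (n - 1))))
    (by rw [← MulOpposite.op_pow, ← pow_mul, mul_comm, pow_mul, g_pow, one_pow]; rfl)
    (by
      rw [← MulOpposite.op_pow, neg_pow, mul_pow_eq_zero_of_qcomm g_pow_mul_x x_pow]; simp)
    (by
      have h : g hn hω ^ (n - 1) * y hn hω = ω⁻¹ • (y hn hω * g hn hω ^ (n - 1)) := by
        rw [y_mul_g_pow, smul_smul, inv_mul_cancel₀ (hω.ne_zero (by omega)), one_smul]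
      rw [← MulOpposite.op_pow, neg_pow, mul_pow_eq_zero_of_qcomm h y_pow]; simp)
    (by
      rw [← MulOpposite.op_mul, ← MulOpposite.op_mul, ← MulOpposite.op_smul, mul_neg, neg_mul,
        ← mul_assoc, g_pow_mul_x, smul_mul_assoc, smul_neg])
    (by
      rw [← MulOpposite.op_mul, ← MulOpposite.op_mul, ← MulOpposite.op_smul, mul_neg, neg_mul,
        ← mul_assoc, smul_neg, ← smul_mul_assoc, ← y_mul_g_pow])
    (by
      rw [← MulOpposite.op_mul, ← MulOpposite.op_mul, ← MulOpposite.op_smul, neg_mul_neg,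
        neg_mul_neg]
      congr 1
      calc y hn hω * g hn hω ^ (n - 1) * (x hn hω * g hn hω ^ (n - 1))
          = y hn hω * (g hn hω ^ (n - 1) * x hn hω) * g hn hω ^ (n - 1) := by
            simp only [mul_assoc]
        _ = (ω • (y hn hω * x hn hω)) * g hn hω ^ (n - 1) * g hn hω ^ (n - 1) := by
            rw [g_pow_mul_x, mul_smul_comm, smul_mul_assoc, smul_mul_assoc, smul_mul_assoc]
            simp only [mul_assoc]
        _ = x hn hω * (y hn hω * g hn hω ^ (n - 1)) * g hn hω ^ (n - 1) := by
            rw [← x_mul_y, mul_assoc (x hn hω)]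
        _ = x hn hω * (ω • (g hn hω ^ (n - 1) * y hn hω)) * g hn hω ^ (n - 1) := by
            rw [y_mul_g_pow]
        _ = _ := by
            rw [mul_smul_comm, smul_mul_assoc]
            simp only [mul_assoc])

noncomputable instance instBialgebra : Bialgebra ℂ (RadfordAlgebra hn hω) :=
  Bialgebra.ofAlgHom (comulHom hn hω) (counitHom hn hω)
    (algHom_ext
      (by simp [comulHom, lift_g])
      (by simp [comulHom, lift_g, lift_x, TensorProduct.add_tmul, TensorProduct.tmul_add,
        Algebra.TensorProduct.one_def, add_assoc])
      (by simp [comulHom, lift_g, lift_y, TensorProduct.add_tmul, TensorProduct.tmul_add,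
        Algebra.TensorProduct.one_def, add_assoc]))
    (algHom_ext
      (by simp [comulHom, counitHom, lift_g])
      (by simp [comulHom, counitHom, lift_x])
      (by simp [comulHom, counitHom, lift_y]))
    (algHom_ext
      (by simp [comulHom, counitHom, lift_g])
      (by simp [comulHom, counitHom, lift_g, lift_x])
      (by simp [comulHom, counitHom, lift_g, lift_y]))

theorem comul_g : Coalgebra.comul (R := ℂ) (g hn hω) = g hn hω ⊗ₜ[ℂ] g hn hω :=
  lift_g

theorem comul_x :
    Coalgebra.comul (R := ℂ) (x hn hω) = x hn hω ⊗ₜ[ℂ] g hn hω + 1 ⊗ₜ[ℂ] x hn hω :=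
  lift_x

theorem comul_y :
    Coalgebra.comul (R := ℂ) (y hn hω) = y hn hω ⊗ₜ[ℂ] g hn hω + 1 ⊗ₜ[ℂ] y hn hω :=
  lift_y

theorem counit_g : Coalgebra.counit (R := ℂ) (g hn hω) = 1 := lift_g

theorem counit_x : Coalgebra.counit (R := ℂ) (x hn hω) = 0 := lift_x

theorem counit_y : Coalgebra.counit (R := ℂ) (y hn hω) = 0 := lift_y

variable (hn hω) in
/-- The antipode `S` as a linear map. -/
noncomputable def antipodeLin :
    RadfordAlgebra hn hω →ₗ[ℂ] RadfordAlgebra hn hω :=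
  (MulOpposite.opLinearEquiv ℂ).symm.toLinearMap ∘ₗ (antipodeHom hn hω).toLinearMap

theorem antipodeLin_g : antipodeLin hn hω (g hn hω) = g hn hω ^ (n - 1) := by
  simp [antipodeLin, antipodeHom, lift_g]

theorem antipodeLin_x : antipodeLin hn hω (x hn hω) = -(x hn hω * g hn hω ^ (n - 1)) := by
  simp [antipodeLin, antipodeHom, lift_x]

theorem antipodeLin_y : antipodeLin hn hω (y hn hω) = -(y hn hω * g hn hω ^ (n - 1)) := by
  simp [antipodeLin, antipodeHom, lift_y]

theorem antipodeLin_mul (a b : RadfordAlgebra hn hω) :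
    antipodeLin hn hω (a * b) = antipodeLin hn hω b * antipodeLin hn hω a := by
  simp [antipodeLin]

theorem antipodeLin_one : antipodeLin hn hω 1 = 1 := by
  simp [antipodeLin]

theorem mul_antipode_left_mul (u v : RadfordAlgebra hn hω ⊗[ℂ] RadfordAlgebra hn hω) (c : ℂ)
    (hu : LinearMap.mul' ℂ _ ((antipodeLin hn hω).rTensor _ u) = algebraMap ℂ _ c) :
    LinearMap.mul' ℂ _ ((antipodeLin hn hω).rTensor _ (u * v)) =
      c • LinearMap.mul' ℂ _ ((antipodeLin hn hω).rTensor _ v) := by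
  have key : ∀ (b₁ b₂ : RadfordAlgebra hn hω)
      (w : RadfordAlgebra hn hω ⊗[ℂ] RadfordAlgebra hn hω),
      LinearMap.mul' ℂ _ ((antipodeLin hn hω).rTensor _ (w * b₁ ⊗ₜ b₂)) =
        antipodeLin hn hω b₁ * LinearMap.mul' ℂ _ ((antipodeLin hn hω).rTensor _ w) * b₂ := by
    intro b₁ b₂ w
    induction w with
    | zero => simp
    | tmul p q => simp [antipodeLin_mul, mul_assoc]
    | add p q hp hq => simp only [add_mul, map_add, mul_add, hp, hq]
  induction v with
  | zero => simp
  | tmul b₁ b₂ =>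
    rw [key, hu]
    simp [Algebra.algebraMap_eq_smul_one]
  | add p q hp hq => simp only [map_add, mul_add, hp, hq, smul_add]

theorem mul_antipode_right_mul (u v : RadfordAlgebra hn hω ⊗[ℂ] RadfordAlgebra hn hω) (c : ℂ)
    (hv : LinearMap.mul' ℂ _ ((antipodeLin hn hω).lTensor _ v) = algebraMap ℂ _ c) :
    LinearMap.mul' ℂ _ ((antipodeLin hn hω).lTensor _ (u * v)) =
      c • LinearMap.mul' ℂ _ ((antipodeLin hn hω).lTensor _ u) := by
  have key : ∀ (a₁ a₂ : RadfordAlgebra hn hω)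
      (w : RadfordAlgebra hn hω ⊗[ℂ] RadfordAlgebra hn hω),
      LinearMap.mul' ℂ _ ((antipodeLin hn hω).lTensor _ (a₁ ⊗ₜ a₂ * w)) =
        a₁ * LinearMap.mul' ℂ _ ((antipodeLin hn hω).lTensor _ w) * antipodeLin hn hω a₂ := by
    intro a₁ a₂ w
    induction w with
    | zero => simp
    | tmul p q => simp [antipodeLin_mul, mul_assoc]
    | add p q hp hq => simp only [add_mul, map_add, mul_add, hp, hq]
  induction u with
  | zero => simp
  | tmul a₁ a₂ =>
    rw [key, hv]
    simp [Algebra.algebraMap_eq_smul_one]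
  | add p q hp hq => simp only [map_add, add_mul, hp, hq, smul_add]

/-- The Hopf algebra structure of the Radford algebra. -/
noncomputable instance instHopfAlgebra : HopfAlgebra ℂ (RadfordAlgebra hn hω) where
  antipode := antipodeLin hn hω
  mul_antipode_rTensor_comul := by
    refine LinearMap.ext fun h => ?_
    simp only [LinearMap.comp_apply, Algebra.linearMap_apply]
    induction h using RadfordAlgebra.induction with
    | halg c =>
      simp [Algebra.algebraMap_eq_smul_one, Algebra.TensorProduct.one_def, antipodeLin_one]
    | hg => simp [comul_g, counit_g, antipodeLin_g, g_pow_mul_g]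
    | hx => simp [comul_x, counit_x, antipodeLin_x, antipodeLin_one, mul_assoc, g_pow_mul_g]
    | hy => simp [comul_y, counit_y, antipodeLin_y, antipodeLin_one, mul_assoc, g_pow_mul_g]
    | hmul a b ha hb =>
      rw [Bialgebra.comul_mul, mul_antipode_left_mul _ _ _ ha, hb, Bialgebra.counit_mul, map_mul,
        Algebra.smul_def]
    | hadd a b ha hb => simp only [map_add, ha, hb]
  mul_antipode_lTensor_comul := by
    refine LinearMap.ext fun h => ?_
    simp only [LinearMap.comp_apply, Algebra.linearMap_apply]
    induction h using RadfordAlgebra.induction with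
    | halg c =>
      simp [Algebra.algebraMap_eq_smul_one, Algebra.TensorProduct.one_def, antipodeLin_one]
    | hg => simp [comul_g, counit_g, antipodeLin_g, g_mul_g_pow]
    | hx => simp [comul_x, counit_x, antipodeLin_x, antipodeLin_g]
    | hy => simp [comul_y, counit_y, antipodeLin_y, antipodeLin_g]
    | hmul a b ha hb =>
      rw [Bialgebra.comul_mul, mul_antipode_right_mul _ _ _ hb, ha, Bialgebra.counit_mul, map_mul,
        Algebra.smul_def]
      exact Algebra.commutes _ _
    | hadd a b ha hb => simp only [map_add, ha, hb]

theorem antipode_g : HopfAlgebra.antipode ℂ (g hn hω) = g hn hω ^ (n - 1) := antipodeLin_g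

theorem antipode_x :
    HopfAlgebra.antipode ℂ (x hn hω) = -(x hn hω * g hn hω ^ (n - 1)) := antipodeLin_x

theorem antipode_y :
    HopfAlgebra.antipode ℂ (y hn hω) = -(y hn hω * g hn hω ^ (n - 1)) := antipodeLin_y

end RadfordAlgebra

/-- A conjugate-linear map `σ : H → H`, `σ h = h^*`, is a `*`-structure on the Hopf algebra `H`
over `ℂ` if `(h^*)^* = h`, `(h l)^* = l^* h^*`, `∑ (h^*)₁ ⊗ (h^*)₂ = ∑ (h₁)^* ⊗ (h₂)^*` and
`S(S(h^*)^*) = h` for all `h, l`. -/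
structure IsHopfStarStructure {H : Type*} [Ring H] [HopfAlgebra ℂ H]
    (σ : H →ₛₗ[starRingEnd ℂ] H) : Prop where
  involutive : ∀ h, σ (σ h) = h
  map_mul : ∀ h l, σ (h * l) = σ l * σ h
  comul_map : ∀ h, Coalgebra.comul (R := ℂ) (σ h) =
    TensorProduct.map σ σ (Coalgebra.comul (R := ℂ) h)
  antipode_map : ∀ h, HopfAlgebra.antipode ℂ (σ (HopfAlgebra.antipode ℂ (σ h))) = h

/-! A `*`-structure is determined by its values on `g, x, y`, and the coalgebra structure leaves few
candidates: `σ g` is grouplike and `σ x`, `σ y` are skew primitive. These elements are found with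
two skew derivations, `derX` and `derY`, which contract the second factor of `Δ` with a matrix
coefficient of a triangular two-dimensional representation. Both lower exponents in the monomials
`g^i y^j x^k`, hence are nilpotent, and their common kernel is ℂ[g] (`mem_spanG_of_der_eq_zero`). A
grouplike element is an eigenvector of each, so nilpotence puts it in ℂ[g]; a skew primitive one
lies in `ℂx + ℂy + ℂ[g]` (`skewPrimitive_eq`). Only the spanning property of the monomials is
needed, not their independence.

If `σ g ≠ g`, then `σ x` lies in ℂ[g] and commutes with `σ g`, which is absurd (`star_g`). Once `σ g
= g`, commutation with `g` removes the ℂ[g] part, and also the mixing of `x` with `y` unless `ω =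
ω⁻¹`, that is, `n = 2` (`exists_actsBy`). So `σ` acts by a matrix `A`, and involutivity on `ℂx + ℂy`
is `ĀA = 1`.

Conversely, the presentation of `H`, applied to maps into the conjugate opposite algebra, produces
`σ` from `A` (`exists_conj_antihom_of_matrix`), and the axioms need checking only on generators
(`isHopfStarStructure_of_generators`). -/

namespace RadfordAlgebra

variable {n : ℕ} {ω : ℂ} {hn : 1 < n} {hω : IsPrimitiveRoot ω n}

/-! ### Contracting the comultiplication with matrix coefficients -/

section Slice

/-- Contraction of the second tensor factor with a matrix coefficient of a representation. -/
noncomputable def slice (ρ : RadfordAlgebra hn hω →ₐ[ℂ] Matrix (Fin 2) (Fin 2) ℂ) (i j : Fin 2) :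
    RadfordAlgebra hn hω ⊗[ℂ] RadfordAlgebra hn hω →ₗ[ℂ] RadfordAlgebra hn hω :=
  (TensorProduct.rid ℂ _).toLinearMap ∘ₗ
    (Matrix.entryLinearMap ℂ ℂ i j ∘ₗ ρ.toLinearMap).lTensor _

theorem slice_tmul (ρ : RadfordAlgebra hn hω →ₐ[ℂ] Matrix (Fin 2) (Fin 2) ℂ) (i j : Fin 2)
    (a b : RadfordAlgebra hn hω) : slice ρ i j (a ⊗ₜ b) = ρ b i j • a := by
  simp [slice]

/-- Entry `(i, j)` of `ρ b * ρ r` expands along row `i`. Since `Δ` is multiplicative, this becomes a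
twisted Leibniz rule for `coeffAct`. -/
theorem slice_tmul_mul (ρ : RadfordAlgebra hn hω →ₐ[ℂ] Matrix (Fin 2) (Fin 2) ℂ) (i j : Fin 2)
    (a b : RadfordAlgebra hn hω) (w : RadfordAlgebra hn hω ⊗[ℂ] RadfordAlgebra hn hω) :
    slice ρ i j (a ⊗ₜ b * w) =
      ρ b i 0 • (a * slice ρ 0 j w) + ρ b i 1 • (a * slice ρ 1 j w) := by
  induction w with
  | zero => simp
  | tmul p r =>
    simp only [Algebra.TensorProduct.tmul_mul_tmul, slice_tmul, map_mul, Matrix.mul_apply,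
      Fin.sum_univ_two, add_smul, mul_smul, mul_smul_comm]
  | add p r hp hr => simp only [mul_add, map_add, hp, hr, smul_add]; abel

/-- The right action of a matrix coefficient on `H`, `h ↦ ∑ ρ(h₂)ᵢⱼ h₁`. -/
noncomputable def coeffAct (ρ : RadfordAlgebra hn hω →ₐ[ℂ] Matrix (Fin 2) (Fin 2) ℂ)
    (i j : Fin 2) : RadfordAlgebra hn hω →ₗ[ℂ] RadfordAlgebra hn hω :=
  slice ρ i j ∘ₗ Coalgebra.comul

theorem coeffAct_apply (ρ : RadfordAlgebra hn hω →ₐ[ℂ] Matrix (Fin 2) (Fin 2) ℂ) (i j : Fin 2)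
    (h : RadfordAlgebra hn hω) : coeffAct ρ i j h = slice ρ i j (Coalgebra.comul h) := rfl

end Slice

/-! ### Skew derivations from triangular representations -/

section TriangularRep

variable (hn hω) in
/-- The two-dimensional representation `g ↦ diag(1, q)`, `x ↦ c E₁₂`, `y ↦ d E₁₂`. -/
noncomputable def triRep (q c d : ℂ) (hq : q ^ n = 1) (hc : c * q = ω * c) (hd : ω * (d * q) = d) :
    RadfordAlgebra hn hω →ₐ[ℂ] Matrix (Fin 2) (Fin 2) ℂ :=
  lift hn hω (Matrix.diagonal ![1, q]) !![0, c; 0, 0] !![0, d; 0, 0]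
    (by
      rw [Matrix.diagonal_pow, ← Matrix.diagonal_one]
      congr 1
      ext i; fin_cases i <;> simp [hq])
    (pow_eq_zero_of_le hn (by ext i j; fin_cases i <;> fin_cases j <;> simp [pow_two]))
    (pow_eq_zero_of_le hn (by ext i j; fin_cases i <;> fin_cases j <;> simp [pow_two]))
    -- The relation `x g = ω g x` reads `c q = ω c`, and the next one `d = ω d q`. A nonzero `c`
    -- forces `q = ω` and a nonzero `d` forces `q = ω⁻¹`, so `x` and `y` generally need separate
    -- representations.
    (by ext i j; fin_cases i <;> fin_cases j <;> simp [hc])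
    (by
      ext i j
      rw [Matrix.smul_apply, Matrix.diagonal_mul, Matrix.mul_diagonal]
      fin_cases i <;> fin_cases j <;> simp [hd])
    (by ext i j; fin_cases i <;> fin_cases j <;> simp)

variable {q c d : ℂ} {hq : q ^ n = 1} {hc : c * q = ω * c} {hd : ω * (d * q) = d}

theorem triRep_g : triRep hn hω q c d hq hc hd (g hn hω) = Matrix.diagonal ![1, q] := lift_g

theorem triRep_x : triRep hn hω q c d hq hc hd (x hn hω) = !![0, c; 0, 0] := lift_x

theorem triRep_y : triRep hn hω q c d hq hc hd (y hn hω) = !![0, d; 0, 0] := lift_y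

variable (hn hω) in
/-- The skew derivation with `g ↦ 0`, `x ↦ c`, `y ↦ d`. -/
noncomputable def skewDer (q c d : ℂ) (hq : q ^ n = 1) (hc : c * q = ω * c)
    (hd : ω * (d * q) = d) : RadfordAlgebra hn hω →ₗ[ℂ] RadfordAlgebra hn hω :=
  coeffAct (triRep hn hω q c d hq hc hd) 0 1

variable (hn hω) in
/-- The twist of the skew derivation `skewDer`. -/
noncomputable def skewTwist (q c d : ℂ) (hq : q ^ n = 1) (hc : c * q = ω * c)
    (hd : ω * (d * q) = d) : RadfordAlgebra hn hω →ₗ[ℂ] RadfordAlgebra hn hω :=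
  coeffAct (triRep hn hω q c d hq hc hd) 1 1

theorem skewDer_one : skewDer hn hω q c d hq hc hd 1 = 0 := by
  simp [skewDer, coeffAct_apply, Algebra.TensorProduct.one_def, slice_tmul]

theorem skewTwist_one : skewTwist hn hω q c d hq hc hd 1 = 1 := by
  simp [skewTwist, coeffAct_apply, Algebra.TensorProduct.one_def, slice_tmul]

theorem skewDer_g_mul (h : RadfordAlgebra hn hω) :
    skewDer hn hω q c d hq hc hd (g hn hω * h) = g hn hω * skewDer hn hω q c d hq hc hd h := by
  simp [skewDer, coeffAct_apply, comul_g, slice_tmul_mul, triRep_g]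

theorem skewDer_x_mul (h : RadfordAlgebra hn hω) :
    skewDer hn hω q c d hq hc hd (x hn hω * h) =
      x hn hω * skewDer hn hω q c d hq hc hd h + c • skewTwist hn hω q c d hq hc hd h := by
  simp [skewDer, skewTwist, coeffAct_apply, comul_x, slice_tmul_mul, triRep_g, triRep_x, add_mul]

theorem skewDer_y_mul (h : RadfordAlgebra hn hω) :
    skewDer hn hω q c d hq hc hd (y hn hω * h) =
      y hn hω * skewDer hn hω q c d hq hc hd h + d • skewTwist hn hω q c d hq hc hd h := by
  simp [skewDer, skewTwist, coeffAct_apply, comul_y, slice_tmul_mul, triRep_g, triRep_y, add_mul]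

theorem skewTwist_x_mul (h : RadfordAlgebra hn hω) :
    skewTwist hn hω q c d hq hc hd (x hn hω * h) =
      q • (x hn hω * skewTwist hn hω q c d hq hc hd h) := by
  simp [skewTwist, coeffAct_apply, comul_x, slice_tmul_mul, triRep_g, triRep_x, add_mul]

theorem skewTwist_y_mul (h : RadfordAlgebra hn hω) :
    skewTwist hn hω q c d hq hc hd (y hn hω * h) =
      q • (y hn hω * skewTwist hn hω q c d hq hc hd h) := by
  simp [skewTwist, coeffAct_apply, comul_y, slice_tmul_mul, triRep_g, triRep_y, add_mul]

theorem skewDer_x : skewDer hn hω q c d hq hc hd (x hn hω) = c • 1 := by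
  simpa [skewDer_one, skewTwist_one] using skewDer_x_mul (hc := hc) (hq := hq) (hd := hd)
    (1 : RadfordAlgebra hn hω)

theorem skewDer_y : skewDer hn hω q c d hq hc hd (y hn hω) = d • 1 := by
  simpa [skewDer_one, skewTwist_one] using skewDer_y_mul (hc := hc) (hq := hq) (hd := hd)
    (1 : RadfordAlgebra hn hω)

theorem skewTwist_x_pow (k : ℕ) :
    skewTwist hn hω q c d hq hc hd (x hn hω ^ k) = q ^ k • x hn hω ^ k := by
  induction k with
  | zero => simp [skewTwist_one]
  | succ k ih => rw [pow_succ', skewTwist_x_mul, ih, mul_smul_comm, smul_smul, ← pow_succ']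

theorem skewTwist_y_pow_mul_x_pow (j k : ℕ) :
    skewTwist hn hω q c d hq hc hd (y hn hω ^ j * x hn hω ^ k) =
      q ^ (j + k) • (y hn hω ^ j * x hn hω ^ k) := by
  induction j with
  | zero => simp [skewTwist_x_pow]
  | succ j ih =>
    rw [pow_succ', mul_assoc, skewTwist_y_mul, ih, mul_smul_comm, smul_smul, ← pow_succ',
      add_right_comm]

theorem skewDer_g_pow_mul (i : ℕ) (h : RadfordAlgebra hn hω) :
    skewDer hn hω q c d hq hc hd (g hn hω ^ i * h) =
      g hn hω ^ i * skewDer hn hω q c d hq hc hd h := by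
  induction i with
  | zero => simp
  | succ i ih => rw [pow_succ', mul_assoc, skewDer_g_mul, ih, mul_assoc]

/-- The `q`-analogue of the power rule: each factor `x` passed by the derivation costs a twist, so
the exponent is replaced by a `q`-integer. -/
theorem skewDer_x_pow_succ (k : ℕ) :
    skewDer hn hω q c d hq hc hd (x hn hω ^ (k + 1)) =
      (c * ∑ i ∈ Finset.range (k + 1), q ^ i) • x hn hω ^ k := by
  induction k with
  | zero => simp [skewDer_x]
  | succ k ih =>
    rw [pow_succ', skewDer_x_mul, ih, skewTwist_x_pow, mul_smul_comm, smul_smul, ← pow_succ',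
      ← add_smul, Finset.sum_range_succ _ (k + 1), mul_add]

/-- With `c = 0` the powers of `x` are constants for the derivation; they enter only through the
twist, which gives the factor `q ^ k`. -/
theorem skewDer_y_pow_succ_mul_x_pow (hc0 : c = 0) (j k : ℕ) :
    skewDer hn hω q c d hq hc hd (y hn hω ^ (j + 1) * x hn hω ^ k) =
      (d * (q ^ k * ∑ i ∈ Finset.range (j + 1), q ^ i)) • (y hn hω ^ j * x hn hω ^ k) := by
  have h0 : skewDer hn hω q c d hq hc hd (x hn hω ^ k) = 0 := by
    cases k with
    | zero => simp [skewDer_one]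
    | succ k => simp [skewDer_x_pow_succ, hc0]
  induction j with
  | zero => simp [skewDer_y_mul, h0, skewTwist_x_pow, smul_smul]
  | succ j ih =>
    rw [pow_succ', mul_assoc, skewDer_y_mul, ih, skewTwist_y_pow_mul_x_pow, mul_smul_comm,
      smul_smul, ← mul_assoc (y hn hω), ← pow_succ', ← add_smul, Finset.sum_range_succ _ (j + 1)]
    congr 1
    ring

theorem skewDer_y_pow_mul (hd0 : d = 0) (j : ℕ) (h : RadfordAlgebra hn hω) :
    skewDer hn hω q c d hq hc hd (y hn hω ^ j * h) =
      y hn hω ^ j * skewDer hn hω q c d hq hc hd h := by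
  induction j with
  | zero => simp
  | succ j ih => 
    rw [pow_succ', mul_assoc, skewDer_y_mul, ih, mul_assoc, add_eq_left, smul_eq_zero]
    exact Or.inl hd0

end TriangularRep

/-! ### Spanning by monomials -/

section Monomials

variable (hn hω) in
/-- The monomials `g^i y^j x^k`. -/
noncomputable def monomial (i j k : ℕ) : RadfordAlgebra hn hω :=
  g hn hω ^ i * (y hn hω ^ j * x hn hω ^ k)

theorem y_mul_g : y hn hω * g hn hω = ω⁻¹ • (g hn hω * y hn hω) := by
  rw [g_mul_y, smul_smul, inv_mul_cancel₀ (hω.ne_zero (by omega)), one_smul]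

theorem g_mul_x : g hn hω * x hn hω = ω⁻¹ • (x hn hω * g hn hω) := by
  rw [x_mul_g, smul_smul, inv_mul_cancel₀ (hω.ne_zero (by omega)), one_smul]

theorem y_mul_x : y hn hω * x hn hω = ω⁻¹ • (x hn hω * y hn hω) := by
  rw [x_mul_y, smul_smul, inv_mul_cancel₀ (hω.ne_zero (by omega)), one_smul]

theorem y_mul_monomial (i j k : ℕ) :
    y hn hω * monomial hn hω i j k = ω⁻¹ ^ i • monomial hn hω i (j + 1) k := by
  rw [monomial, monomial, ← mul_assoc, mul_pow_of_qcomm y_mul_g, smul_mul_assoc, pow_succ']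
  simp only [mul_assoc]

theorem x_mul_monomial (i j k : ℕ) :
    x hn hω * monomial hn hω i j k = ω ^ (i + j) • monomial hn hω i j (k + 1) := by
  rw [monomial, monomial, ← mul_assoc, mul_pow_of_qcomm x_mul_g, smul_mul_assoc, mul_assoc,
    ← mul_assoc (x hn hω), mul_pow_of_qcomm x_mul_y, smul_mul_assoc, mul_smul_comm, smul_smul,
    pow_succ' (x hn hω), pow_add]
  simp only [mul_assoc]

theorem monomial_eq_zero_of_le {i j k : ℕ} (h : n ≤ j ∨ n ≤ k) : monomial hn hω i j k = 0 := by
  rcases h with h | h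
  · simp [monomial, pow_eq_zero_of_le h y_pow]
  · simp [monomial, pow_eq_zero_of_le h x_pow]

-- Each generator sends a monomial to a multiple of a monomial, so the span is a left ideal
-- containing `1`. The bounds on `j` and `k` later keep the `q`-integers nonzero; `i` needs no
-- bound.
variable (hn hω) in
theorem mem_span_monomial (h : RadfordAlgebra hn hω) :
    h ∈ Submodule.span ℂ {m | ∃ i j k, j < n ∧ k < n ∧ monomial hn hω i j k = m} := by
  set W := Submodule.span ℂ {m | ∃ i j k, j < n ∧ k < n ∧ monomial hn hω i j k = m} with hW
  have hmem : ∀ i j k, monomial hn hω i j k ∈ W := by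
    intro i j k
    by_cases h : j < n ∧ k < n
    · exact Submodule.subset_span ⟨i, j, k, h.1, h.2, rfl⟩
    · rw [monomial_eq_zero_of_le (by omega)]; exact W.zero_mem
  have hgen : ∀ a : RadfordAlgebra hn hω, (∀ i j k, a * monomial hn hω i j k ∈ W) →
      ∀ w ∈ W, a * w ∈ W := by
    intro a ha w hw
    induction hw using Submodule.span_induction with
    | mem w hw => obtain ⟨i, j, k, -, -, rfl⟩ := hw; exact ha i j k
    | zero => simp
    | add p r _ _ hp hr => rw [mul_add]; exact W.add_mem hp hr
    | smul c p _ hp => rw [mul_smul_comm]; exact W.smul_mem c hp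
  -- Stability of the whole span under `h`, unlike membership of `h`, passes directly to products.
  have key : ∀ w ∈ W, h * w ∈ W := by
    induction h using RadfordAlgebra.induction with
    | halg c => intro w hw; rw [← Algebra.smul_def]; exact W.smul_mem c hw
    | hg =>
      refine hgen _ fun i j k => ?_
      have : g hn hω * monomial hn hω i j k = monomial hn hω (i + 1) j k := by
        simp only [monomial, pow_succ', mul_assoc]
      rw [this]; exact hmem _ _ _
    | hx => exact hgen _ fun i j k => x_mul_monomial i j k ▸ W.smul_mem _ (hmem _ _ _)
    | hy => exact hgen _ fun i j k => y_mul_monomial i j k ▸ W.smul_mem _ (hmem _ _ _)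
    | hmul a b ha hb => intro w hw; rw [mul_assoc]; exact ha _ (hb _ hw)
    | hadd a b ha hb => intro w hw; rw [add_mul]; exact W.add_mem (ha _ hw) (hb _ hw)
  simpa [monomial] using key _ (hmem 0 0 0)

end Monomials

end RadfordAlgebra

/-! ### Diagonal and lowering operators -/

section LinearAlgebra

variable {K M : Type*} [Field K] [AddCommGroup M] [Module K M]

/-- If `span s` is spanned by eigenvectors of `N`, then its intersection with `ker N` is spanned by
the eigenvectors of eigenvalue zero. -/
theorem Module.End.mem_span_of_apply_eq_zero (N : Module.End K M) {s t : Set M}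
    (ht : ∀ w ∈ t, N w = 0) (hs : ∀ w ∈ s, w ∈ t ∨ ∃ μ : K, μ ≠ 0 ∧ N w = μ • w)
    {v : M} (hv : v ∈ Submodule.span K s) (hNv : N v = 0) : v ∈ Submodule.span K t := by
  have hle : Submodule.span K s ≤ Submodule.span K t ⊔ ⨆ μ ≠ (0 : K), N.eigenspace μ := by
    rw [Submodule.span_le]
    intro w hw
    rcases hs w hw with h | ⟨μ, hμ, h⟩
    · exact Submodule.mem_sup_left (Submodule.subset_span h)
    · refine Submodule.mem_sup_right ?_
      exact Submodule.mem_iSup_of_mem μ (Submodule.mem_iSup_of_mem hμ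
        (Module.End.mem_eigenspace_iff.2 h))
  have hker : Submodule.span K t ≤ N.eigenspace 0 := by
    rw [Submodule.span_le]
    intro w hw
    simp [ht w hw]
  obtain ⟨a, ha, b, hb, rfl⟩ := Submodule.mem_sup.1 (hle hv)
  -- Both `a` and `a + b` are killed by `N`, so `b` lies in the kernel as well as in the sum of the
  -- other eigenspaces; independence gives `b = 0`.
  have hb0 : b ∈ N.eigenspace 0 := by
    have := (N.eigenspace 0).sub_mem (x := a + b) (y := a) (by simpa using hNv) (hker ha)
    simpa using this
  have := (Submodule.disjoint_def.1 (N.eigenspaces_iSupIndep 0)) b hb0 hb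
  simpa [this] using ha

/-- An operator that lowers a chain of vectors acts nilpotently on them. -/
theorem Module.End.pow_apply_eq_zero_of_lowering (D : Module.End K M) (e : ℕ → M) (c : ℕ → K)
    (h0 : D (e 0) = 0) (hs : ∀ k, D (e (k + 1)) = c k • e k) {m k : ℕ} (hk : k < m) :
    (D ^ m) (e k) = 0 := by
  induction k generalizing m with
  | zero =>
    obtain ⟨m, rfl⟩ : ∃ j, m = j + 1 := ⟨m - 1, by omega⟩
    rw [pow_succ, Module.End.mul_apply, h0, map_zero]
  | succ k ih =>
    obtain ⟨m, rfl⟩ : ∃ j, m = j + 1 := ⟨m - 1, by omega⟩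
    rw [pow_succ, Module.End.mul_apply, hs, map_smul, ih (by omega), smul_zero]

end LinearAlgebra

/-! ### The partial skew derivatives and their common kernel -/

namespace RadfordAlgebra

variable {n : ℕ} {ω : ℂ} {hn : 1 < n} {hω : IsPrimitiveRoot ω n}

theorem geom_sum_ne_zero_of_primitive {q : ℂ} (hq : IsPrimitiveRoot q n) {k : ℕ}
    (hk : k + 1 < n) : ∑ i ∈ Finset.range (k + 1), q ^ i ≠ 0 := by
  intro h
  have := geom_sum_mul q (k + 1)
  rw [h, zero_mul] at this
  exact hq.pow_ne_one_of_pos_of_lt k.succ_ne_zero hk (sub_eq_zero.1 this.symm)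

variable (hn hω) in
/-- The representation `g ↦ diag(1, ω)`, `x ↦ E₁₂`, `y ↦ 0`. -/
noncomputable def repX : RadfordAlgebra hn hω →ₐ[ℂ] Matrix (Fin 2) (Fin 2) ℂ :=
  triRep hn hω ω 1 0 hω.pow_eq_one (by simp) (by simp)

variable (hn hω) in
/-- The representation `g ↦ diag(1, ω⁻¹)`, `x ↦ 0`, `y ↦ E₁₂`. -/
noncomputable def repY : RadfordAlgebra hn hω →ₐ[ℂ] Matrix (Fin 2) (Fin 2) ℂ :=
  triRep hn hω ω⁻¹ 0 1 hω.inv.pow_eq_one (by simp)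
    (by rw [one_mul, mul_inv_cancel₀ (hω.ne_zero (by omega))])

variable (hn hω) in
/-- The skew derivation `∂/∂x`. -/
noncomputable def derX : Module.End ℂ (RadfordAlgebra hn hω) := coeffAct (repX hn hω) 0 1

variable (hn hω) in
/-- The skew derivation `∂/∂y`. -/
noncomputable def derY : Module.End ℂ (RadfordAlgebra hn hω) := coeffAct (repY hn hω) 0 1

theorem derX_monomial_zero (i j : ℕ) : derX hn hω (monomial hn hω i j 0) = 0 := by
  rw [monomial]
  -- `derX` is `skewDer` at `q = ω`, `c = 1`, `d = 0` only after unfolding, hence `erw`; the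
  -- argument `rfl` proves `d = 0`.
  erw [skewDer_g_pow_mul, skewDer_y_pow_mul rfl, pow_zero, skewDer_one]
  simp

theorem derX_monomial_succ (i j k : ℕ) : derX hn hω (monomial hn hω i j (k + 1)) =
    (∑ l ∈ Finset.range (k + 1), ω ^ l) • monomial hn hω i j k := by
  rw [monomial]
  erw [skewDer_g_pow_mul, skewDer_y_pow_mul rfl, skewDer_x_pow_succ]
  simp [monomial]

theorem derY_monomial_zero (i k : ℕ) : derY hn hω (monomial hn hω i 0 k) = 0 := by
  rw [monomial]
  erw [skewDer_g_pow_mul]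
  rcases k with _ | k
  · erw [pow_zero, pow_zero, one_mul, skewDer_one]; simp
  · erw [pow_zero, one_mul, skewDer_x_pow_succ]; simp

theorem derY_monomial_succ (i j k : ℕ) : derY hn hω (monomial hn hω i (j + 1) k) =
    (ω⁻¹ ^ k * ∑ l ∈ Finset.range (j + 1), ω⁻¹ ^ l) • monomial hn hω i j k := by
  rw [monomial]
  erw [skewDer_g_pow_mul, skewDer_y_pow_succ_mul_x_pow rfl]
  simp [monomial]

/-- The derivative lowers the exponent of `x`, which is below `n` in the spanning monomials. -/
theorem derX_pow_eq_zero : derX hn hω ^ n = 0 := by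
  ext h
  refine Submodule.span_induction (p := fun h _ => (derX hn hω ^ n) h = 0) ?_ (map_zero _)
    (fun a b _ _ ha hb => by rw [map_add, ha, hb, add_zero])
    (fun c a _ ha => by rw [map_smul, ha, smul_zero]) (mem_span_monomial hn hω h)
  rintro _ ⟨i, j, k, -, hk, rfl⟩
  exact Module.End.pow_apply_eq_zero_of_lowering _ (fun k => monomial hn hω i j k) _
    (derX_monomial_zero i j) (derX_monomial_succ i j) hk

theorem derY_pow_eq_zero : derY hn hω ^ n = 0 := by
  ext h
  refine Submodule.span_induction (p := fun h _ => (derY hn hω ^ n) h = 0) ?_ (map_zero _)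
    (fun a b _ _ ha hb => by rw [map_add, ha, hb, add_zero])
    (fun c a _ ha => by rw [map_smul, ha, smul_zero]) (mem_span_monomial hn hω h)
  rintro _ ⟨i, j, k, hj, -, rfl⟩
  exact Module.End.pow_apply_eq_zero_of_lowering _ (fun j => monomial hn hω i j k) _
    (derY_monomial_zero i k) (fun j => derY_monomial_succ i j k) hj

variable (hn hω) in
/-- The group algebra of the powers of `g`. -/
noncomputable def spanG : Submodule ℂ (RadfordAlgebra hn hω) :=
  Submodule.span ℂ (Set.range (g hn hω ^ ·))

/-- The common kernel of the two skew derivations is the group algebra. -/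
theorem mem_spanG_of_der_eq_zero {h : RadfordAlgebra hn hω} (hx : derX hn hω h = 0)
    (hy : derY hn hω h = 0) : h ∈ spanG hn hω := by
  have h1 : h ∈ Submodule.span ℂ {m | ∃ i j, j < n ∧ monomial hn hω i j 0 = m} := by
    -- The Euler operator `h ↦ (∂h/∂x) x` is diagonal on monomials, with eigenvalue the `ω`-integer
    -- of the exponent of `x`. This is nonzero for exponents strictly between `0` and `n`.
    refine Module.End.mem_span_of_apply_eq_zero
      (LinearMap.mulRight ℂ (x hn hω) ∘ₗ derX hn hω) ?_ ?_ (mem_span_monomial hn hω h) (by simp [hx])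
    · rintro _ ⟨i, j, -, rfl⟩
      simp [derX_monomial_zero]
    · rintro _ ⟨i, j, k, hj, hk, rfl⟩
      rcases k with _ | k
      · exact Or.inl ⟨i, j, hj, rfl⟩
      · refine Or.inr ⟨_, geom_sum_ne_zero_of_primitive hω hk, ?_⟩
        rw [LinearMap.comp_apply, derX_monomial_succ, map_smul, LinearMap.mulRight_apply, monomial,
          monomial, pow_succ]
        simp only [mul_assoc]
  refine Module.End.mem_span_of_apply_eq_zero
    (LinearMap.mulLeft ℂ (y hn hω) ∘ₗ derY hn hω) ?_ ?_ h1 (by simp [hy])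
  · rintro _ ⟨i, rfl⟩
    have := derY_monomial_zero (hn := hn) (hω := hω) i 0
    simp only [monomial, pow_zero, mul_one] at this
    simp [this]
  · rintro _ ⟨i, j, hj, rfl⟩
    rcases j with _ | j
    · exact Or.inl ⟨i, by simp [monomial]⟩
    -- The Euler operator for `y` multiplies on the left, and moving `y` past `g^i` contributes the
    -- factor `ω⁻¹ ^ i`.
    · refine Or.inr ⟨(∑ l ∈ Finset.range (j + 1), ω⁻¹ ^ l) * ω⁻¹ ^ i,
        mul_ne_zero (geom_sum_ne_zero_of_primitive hω.inv hj)
          (pow_ne_zero _ (inv_ne_zero (hω.ne_zero (by omega)))), ?_⟩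
      rw [LinearMap.comp_apply, derY_monomial_succ, map_smul, LinearMap.mulLeft_apply,
        y_mul_monomial, smul_smul, pow_zero, one_mul]

theorem spanG_commute_g {p : RadfordAlgebra hn hω} (hp : p ∈ spanG hn hω) :
    Commute p (g hn hω) := by
  refine Submodule.span_induction (p := fun p _ => Commute p (g hn hω)) ?_
    (Commute.zero_left _) (fun _ _ _ _ ha hb => ha.add_left hb) (fun c _ _ h => h.smul_left c) hp
  rintro _ ⟨i, rfl⟩
  exact Commute.pow_self _ i

theorem spanG_commute {p r : RadfordAlgebra hn hω} (hp : p ∈ spanG hn hω)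
    (hr : r ∈ spanG hn hω) : Commute p r := by
  refine Submodule.span_induction (p := fun r _ => Commute p r) ?_
    (Commute.zero_right _) (fun _ _ _ _ ha hb => ha.add_right hb) (fun c _ _ h => h.smul_right c) hr
  rintro _ ⟨i, rfl⟩
  exact (spanG_commute_g hp).pow_right i

theorem triRep_spanG {q c d : ℂ} {hq : q ^ n = 1} {hc : c * q = ω * c} {hd : ω * (d * q) = d}
    {p : RadfordAlgebra hn hω} (hp : p ∈ spanG hn hω) :
    triRep hn hω q c d hq hc hd p 0 1 = 0 := by
  refine Submodule.span_induction (p := fun p _ => triRep hn hω q c d hq hc hd p 0 1 = 0) ?_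
    (by simp) (fun _ _ _ _ ha hb => by simp [ha, hb]) (fun c _ _ h => by simp [h]) hp
  rintro _ ⟨i, rfl⟩
  simp [map_pow, triRep_g, Matrix.diagonal_pow]

theorem repX_x : repX hn hω (x hn hω) 0 1 = 1 := by simp [repX, triRep_x]

theorem repX_y : repX hn hω (y hn hω) 0 1 = 0 := by simp [repX, triRep_y]

theorem repY_x : repY hn hω (x hn hω) 0 1 = 0 := by simp [repY, triRep_x]

theorem repY_y : repY hn hω (y hn hω) 0 1 = 1 := by simp [repY, triRep_y]

/-- The upper right entries of `repX` and `repY` are functionals dual to `x` and `y`; they vanish on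
ℂ[g] because `g` acts diagonally. -/
theorem coeff_eq_zero {a b : ℂ} {p : RadfordAlgebra hn hω} (hp : p ∈ spanG hn hω)
    (h : a • x hn hω + b • y hn hω + p = 0) : a = 0 ∧ b = 0 := by
  constructor
  · have := congrArg (fun z => repX hn hω z 0 1) h
    have hp' : repX hn hω p 0 1 = 0 := triRep_spanG hp
    simpa [repX_x, repX_y, hp'] using this
  · have := congrArg (fun z => repY hn hω z 0 1) h
    have hp' : repY hn hω p 0 1 = 0 := triRep_spanG hp
    simpa [repY_x, repY_y, hp'] using this

theorem coeff_ext {a b a' b' : ℂ}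
    (h : a • x hn hω + b • y hn hω = a' • x hn hω + b' • y hn hω) : a = a' ∧ b = b' := by
  have := coeff_eq_zero (a := a - a') (b := b - b') (spanG hn hω).zero_mem
    (by rw [sub_smul, sub_smul, add_zero, ← sub_eq_zero.2 h]; abel)
  exact ⟨sub_eq_zero.1 this.1, sub_eq_zero.1 this.2⟩

theorem x_ne_zero : x hn hω ≠ 0 := by
  intro h
  simpa [h] using repX_x (hn := hn) (hω := hω)

theorem g_ne_zero : g hn hω ≠ 0 := by
  intro h
  simpa [h] using counit_g (hn := hn) (hω := hω)

theorem g_mul_cancel {a b : RadfordAlgebra hn hω} (h : g hn hω * a = g hn hω * b) : a = b := by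
  simpa [← mul_assoc, g_pow_mul_g] using congrArg (g hn hω ^ (n - 1) * ·) h

/-! ### Grouplike and skew primitive elements -/

section Classification

/-- An eigenvalue of a nilpotent operator vanishes. -/
theorem eigenvalue_eq_zero_of_pow_eq_zero {D : Module.End ℂ (RadfordAlgebra hn hω)} {m : ℕ}
    (hD : D ^ m = 0) {c : ℂ} {u : RadfordAlgebra hn hω} (hu : u ≠ 0) (h : D u = c • u) : c = 0 := by
  have key : ∀ k, (D ^ k) u = c ^ k • u := by
    intro k
    induction k with
    | zero => simp
    | succ k ih => rw [pow_succ', Module.End.mul_apply, ih, map_smul, h, smul_smul, pow_succ]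
  have := key m
  rw [hD, LinearMap.zero_apply] at this
  by_contra hc
  exact hu ((smul_eq_zero.1 this.symm).resolve_left (pow_ne_zero m hc))

variable {u v : RadfordAlgebra hn hω}

/-- Contracting `Δ u = u ⊗ u` makes `u` an eigenvector of the nilpotent `derX`, with this entry as
eigenvalue. -/
theorem repX_grouplike (hu : u ≠ 0) (hΔ : Coalgebra.comul (R := ℂ) u = u ⊗ₜ u) :
    repX hn hω u 0 1 = 0 :=
  eigenvalue_eq_zero_of_pow_eq_zero derX_pow_eq_zero hu
    (by rw [derX, coeffAct_apply, hΔ, slice_tmul])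

theorem repY_grouplike (hu : u ≠ 0) (hΔ : Coalgebra.comul (R := ℂ) u = u ⊗ₜ u) :
    repY hn hω u 0 1 = 0 :=
  eigenvalue_eq_zero_of_pow_eq_zero derY_pow_eq_zero hu
    (by rw [derY, coeffAct_apply, hΔ, slice_tmul])

/-- Grouplike elements lie in the group algebra of the powers of `g`. -/
theorem grouplike_mem_spanG (hu : u ≠ 0) (hΔ : Coalgebra.comul (R := ℂ) u = u ⊗ₜ u) :
    u ∈ spanG hn hω :=
  mem_spanG_of_der_eq_zero
    (by rw [derX, coeffAct_apply, hΔ, slice_tmul, repX_grouplike hu hΔ, zero_smul])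
    (by rw [derY, coeffAct_apply, hΔ, slice_tmul, repY_grouplike hu hΔ, zero_smul])

/-- Contraction of the first tensor factor with a matrix coefficient of a representation. -/
noncomputable def leftSlice (ρ : RadfordAlgebra hn hω →ₐ[ℂ] Matrix (Fin 2) (Fin 2) ℂ) :
    RadfordAlgebra hn hω ⊗[ℂ] RadfordAlgebra hn hω →ₗ[ℂ] RadfordAlgebra hn hω :=
  (TensorProduct.lid ℂ _).toLinearMap ∘ₗ
    (Matrix.entryLinearMap ℂ ℂ 0 1 ∘ₗ ρ.toLinearMap).rTensor _

theorem leftSlice_tmul (ρ : RadfordAlgebra hn hω →ₐ[ℂ] Matrix (Fin 2) (Fin 2) ℂ)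
    (a b : RadfordAlgebra hn hω) : leftSlice ρ (a ⊗ₜ b) = ρ a 0 1 • b := by
  simp [leftSlice]

theorem comul_g_pow (i : ℕ) :
    Coalgebra.comul (R := ℂ) (g hn hω ^ i) = (g hn hω ^ i) ⊗ₜ[ℂ] (g hn hω ^ i) := by
  rw [Bialgebra.comul_pow, comul_g, Algebra.TensorProduct.tmul_pow]

theorem leftSlice_comul_spanG {q c d : ℂ} {hq : q ^ n = 1} {hc : c * q = ω * c}
    {hd : ω * (d * q) = d} {p : RadfordAlgebra hn hω} (hp : p ∈ spanG hn hω) :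
    leftSlice (triRep hn hω q c d hq hc hd) (Coalgebra.comul p) = 0 := by
  refine Submodule.span_induction
    (p := fun p _ => leftSlice (triRep hn hω q c d hq hc hd) (Coalgebra.comul p) = 0) ?_
    (by simp) (fun _ _ _ _ ha hb => by simp [ha, hb]) (fun c _ _ h => by simp [h]) hp
  rintro _ ⟨i, rfl⟩
  rw [comul_g_pow, leftSlice_tmul, triRep_spanG (Submodule.subset_span ⟨i, rfl⟩), zero_smul]

/-- The skew primitive elements of the Radford algebra. -/
theorem skewPrimitive_eq (hu : u ≠ 0) (hΔu : Coalgebra.comul (R := ℂ) u = u ⊗ₜ u)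
    (hΔ : Coalgebra.comul (R := ℂ) v = v ⊗ₜ u + 1 ⊗ₜ v) :
    ∃ a b : ℂ, ∃ p ∈ spanG hn hω, v = a • x hn hω + b • y hn hω + p ∧
      (u ≠ g hn hω → a = 0 ∧ b = 0) := by
  -- The summand `v ⊗ u` contributes nothing, because the entry of `u` vanishes. Hence `v` has
  -- constant derivatives, and subtracting `a x + b y` lands in the common kernel.
  have hX : derX hn hω v = repX hn hω v 0 1 • 1 := by
    rw [derX, coeffAct_apply, hΔ, map_add, slice_tmul, slice_tmul, repX_grouplike hu hΔu,
      zero_smul, zero_add]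
  have hY : derY hn hω v = repY hn hω v 0 1 • 1 := by
    rw [derY, coeffAct_apply, hΔ, map_add, slice_tmul, slice_tmul, repY_grouplike hu hΔu,
      zero_smul, zero_add]
  set a := repX hn hω v 0 1
  set b := repY hn hω v 0 1
  have hXx : derX hn hω (x hn hω) = 1 := skewDer_x.trans (by simp)
  have hXy : derX hn hω (y hn hω) = 0 := skewDer_y.trans (by simp)
  have hYx : derY hn hω (x hn hω) = 0 := skewDer_x.trans (by simp)
  have hYy : derY hn hω (y hn hω) = 1 := skewDer_y.trans (by simp)
  obtain ⟨p, hp, hv⟩ : ∃ p ∈ spanG hn hω, v = a • x hn hω + b • y hn hω + p := by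
    refine ⟨v - (a • x hn hω + b • y hn hω), mem_spanG_of_der_eq_zero ?_ ?_, by abel⟩
    · simp [hX, hXx, hXy]
    · simp [hY, hYx, hYy]
  refine ⟨a, b, p, hp, hv, fun hug => ?_⟩
  have hpX : repX hn hω p 0 1 = 0 := triRep_spanG hp
  have hpY : repY hn hω p 0 1 = 0 := triRep_spanG hp
  have hcX : leftSlice (repX hn hω) (Coalgebra.comul p) = 0 := leftSlice_comul_spanG hp
  have hcY : leftSlice (repY hn hω) (Coalgebra.comul p) = 0 := leftSlice_comul_spanG hp
  rw [hv] at hΔ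
  -- Contracting the first factor leaves only `a g` on the left, from `x ⊗ g`, and `a u` on the
  -- right. The same with `repY` gives `b g = b u`.
  have h1 := congrArg (leftSlice (repX hn hω)) hΔ
  have h2 := congrArg (leftSlice (repY hn hω)) hΔ
  simp [comul_x, comul_y, leftSlice_tmul, repX_x, repX_y, hpX, hcX] at h1
  simp [comul_x, comul_y, leftSlice_tmul, repY_x, repY_y, hpY, hcY] at h2
  have hgu : g hn hω - u ≠ 0 := sub_ne_zero.2 (Ne.symm hug)
  rw [← sub_eq_zero, ← smul_sub] at h1 h2
  exact ⟨(smul_eq_zero.1 h1).resolve_right hgu, (smul_eq_zero.1 h2).resolve_right hgu⟩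

/-- Moving `g` from right to left scales `x` by `ω`, `y` by `ω⁻¹` and ℂ[g] by `1`. These three parts
are independent, so each with scalar other than `r` must vanish. -/
theorem coeff_of_mul_g {a b r : ℂ} {p : RadfordAlgebra hn hω} (hr : r ≠ 1)
    (hp : p ∈ spanG hn hω) (hv : v = a • x hn hω + b • y hn hω + p)
    (h : v * g hn hω = r • (g hn hω * v)) :
    v = a • x hn hω + b • y hn hω ∧ a * (ω - r) = 0 ∧ b * (ω⁻¹ - r) = 0 := by
  have h1 : (a * (ω - r)) • x hn hω + (b * (ω⁻¹ - r)) • y hn hω + (1 - r) • p = 0 := by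
    refine g_mul_cancel ?_
    rw [hv] at h
    simp only [add_mul, mul_add, smul_mul_assoc, mul_smul_comm, x_mul_g, y_mul_g,
      (spanG_commute_g hp).eq, mul_zero] at h ⊢
    rw [← sub_eq_zero] at h
    rw [← h]
    module
  obtain ⟨ha, hb⟩ := coeff_eq_zero ((spanG hn hω).smul_mem _ hp) h1
  refine ⟨?_, ha, hb⟩
  rw [ha, hb, zero_smul, zero_smul, zero_add, zero_add, smul_eq_zero] at h1
  rw [hv, h1.resolve_left (sub_ne_zero.2 hr.symm), add_zero]

end Classification

/-! ### Every star structure acts by a matrix -/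

section Star

variable {σ : RadfordAlgebra hn hω →ₛₗ[starRingEnd ℂ] RadfordAlgebra hn hω}

theorem _root_.IsHopfStarStructure.map_one {H : Type*} [Ring H] [HopfAlgebra ℂ H]
    {σ : H →ₛₗ[starRingEnd ℂ] H} (h : IsHopfStarStructure σ) : σ 1 = 1 := by
  calc σ 1 = σ 1 * σ (σ 1) := by rw [h.involutive, mul_one]
    _ = σ (σ 1 * 1) := (h.map_mul _ _).symm
    _ = 1 := by rw [mul_one, h.involutive]

theorem conj_root (hn : 1 < n) (hω : IsPrimitiveRoot ω n) : starRingEnd ℂ ω = ω⁻¹ :=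
  (Complex.inv_eq_conj (hω.norm'_eq_one (by omega))).symm

theorem star_ext {σ τ : RadfordAlgebra hn hω →ₛₗ[starRingEnd ℂ] RadfordAlgebra hn hω}
    (hσ : IsHopfStarStructure σ) (hτ : IsHopfStarStructure τ)
    (hg : σ (g hn hω) = τ (g hn hω)) (hx : σ (x hn hω) = τ (x hn hω))
    (hy : σ (y hn hω) = τ (y hn hω)) : σ = τ := by
  ext h
  induction h using RadfordAlgebra.induction with
  | halg c => rw [Algebra.algebraMap_eq_smul_one, map_smulₛₗ, map_smulₛₗ, hσ.map_one, hτ.map_one]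
  | hg => exact hg
  | hx => exact hx
  | hy => exact hy
  | hmul a b ha hb => rw [hσ.map_mul, hτ.map_mul, ha, hb]
  | hadd a b ha hb => rw [map_add, map_add, ha, hb]

/-- Otherwise `σ x` has no `x` or `y` part and commutes with `σ g` inside ℂ[g]. Applying `σ` again,
`x` commutes with `g`, against `ω ≠ 1`. -/
theorem star_g (hσ : IsHopfStarStructure σ) : σ (g hn hω) = g hn hω := by
  have hu : σ (g hn hω) ≠ 0 := fun h => g_ne_zero (hn := hn) (hω := hω) <| by
    rw [← hσ.involutive (g hn hω), h, map_zero]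
  have hΔu : Coalgebra.comul (R := ℂ) (σ (g hn hω)) = σ (g hn hω) ⊗ₜ σ (g hn hω) := by
    rw [hσ.comul_map, comul_g, TensorProduct.map_tmul]
  have hΔ : Coalgebra.comul (R := ℂ) (σ (x hn hω)) =
      σ (x hn hω) ⊗ₜ σ (g hn hω) + 1 ⊗ₜ σ (x hn hω) := by
    rw [hσ.comul_map, comul_x, map_add, TensorProduct.map_tmul, TensorProduct.map_tmul,
      hσ.map_one]
  obtain ⟨a, b, p, hp, hv, h⟩ := skewPrimitive_eq hu hΔu hΔ
  by_contra hne
  obtain ⟨rfl, rfl⟩ := h hne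
  have hcomm : σ (g hn hω) * σ (x hn hω) = σ (x hn hω) * σ (g hn hω) := by
    rw [hv, zero_smul, zero_smul, zero_add, zero_add]
    exact spanG_commute (grouplike_mem_spanG hu hΔu) hp
  rw [← hσ.map_mul, ← hσ.map_mul] at hcomm
  have h1 : x hn hω * g hn hω = g hn hω * x hn hω := by
    rw [← hσ.involutive (x hn hω * g hn hω), hcomm, hσ.involutive]
  have h2 : ω • x hn hω = x hn hω := g_mul_cancel (by rw [mul_smul_comm, ← x_mul_g, h1])
  have h3 : (ω - 1) • x hn hω = 0 := by rw [sub_smul, h2, one_smul, sub_self]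
  exact (smul_eq_zero.1 h3).elim (sub_ne_zero.2 (hω.ne_one hn)) x_ne_zero

theorem star_skewPrimitive (hσ : IsHopfStarStructure σ) {z : RadfordAlgebra hn hω} {r : ℂ}
    (hr : r ≠ 1) (hz : Coalgebra.comul (R := ℂ) z = z ⊗ₜ g hn hω + 1 ⊗ₜ z)
    (hg : σ z * g hn hω = r • (g hn hω * σ z)) :
    ∃ a b : ℂ, σ z = a • x hn hω + b • y hn hω ∧ a * (ω - r) = 0 ∧ b * (ω⁻¹ - r) = 0 := by
  have hΔ : Coalgebra.comul (R := ℂ) (σ z) = σ z ⊗ₜ g hn hω + 1 ⊗ₜ σ z := by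
    rw [hσ.comul_map, hz, map_add, TensorProduct.map_tmul, TensorProduct.map_tmul,
      hσ.map_one, star_g hσ]
  obtain ⟨a, b, p, hp, hv, -⟩ := skewPrimitive_eq g_ne_zero comul_g hΔ
  exact ⟨a, b, coeff_of_mul_g hr hp hv hg⟩

/-- `σ` acts on the generators through the matrix `A`. -/
def ActsBy (σ : RadfordAlgebra hn hω →ₛₗ[starRingEnd ℂ] RadfordAlgebra hn hω)
    (A : Matrix (Fin 2) (Fin 2) ℂ) : Prop :=
  σ (g hn hω) = g hn hω ∧ σ (x hn hω) = A 0 0 • x hn hω + A 0 1 • y hn hω ∧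
    σ (y hn hω) = A 1 0 • x hn hω + A 1 1 • y hn hω

/-- By conjugate linearity `σ` sends the coefficient row `(a, b)` to `(ā, b̄) A`, so the rows of
`ĀA` are the coefficients of `σ (σ x)` and `σ (σ y)`. -/
theorem conj_mul_eq_one_iff {A : Matrix (Fin 2) (Fin 2) ℂ} (h : ActsBy σ A) :
    A.map (starRingEnd ℂ) * A = 1 ↔
      σ (σ (x hn hω)) = x hn hω ∧ σ (σ (y hn hω)) = y hn hω := by
  obtain ⟨-, hx, hy⟩ := h
  have key : ∀ a b : ℂ, σ (a • x hn hω + b • y hn hω) =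
      (starRingEnd ℂ a * A 0 0 + starRingEnd ℂ b * A 1 0) • x hn hω +
        (starRingEnd ℂ a * A 0 1 + starRingEnd ℂ b * A 1 1) • y hn hω := by
    intro a b
    rw [map_add, map_smulₛₗ, map_smulₛₗ, hx, hy]
    module
  rw [hx, hy, key, key, ← Matrix.ext_iff]
  simp only [Fin.forall_fin_two, Matrix.mul_apply, Fin.sum_univ_two, Matrix.map_apply]
  constructor
  · rintro ⟨⟨h1, h2⟩, h3, h4⟩
    rw [h1, h2, h3, h4]
    simp
  · rintro ⟨h1, h2⟩
    have h1' := coeff_ext (h1.trans (by simp : x hn hω = (1 : ℂ) • x hn hω + (0 : ℂ) • y hn hω))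
    have h2' := coeff_ext (h2.trans (by simp : y hn hω = (0 : ℂ) • x hn hω + (1 : ℂ) • y hn hω))
    simpa using ⟨h1', h2'⟩

/-- Reversing products and conjugating `ω` to `ω⁻¹` cancel out: `σ x` and `σ y` obey the same
commutation with `g` as `x` and `y`. The off-diagonal entries are thus annihilated by `ω - ω⁻¹`, up
to sign. -/
theorem exists_actsBy (hσ : IsHopfStarStructure σ) :
    ∃ A : Matrix (Fin 2) (Fin 2) ℂ, A.map (starRingEnd ℂ) * A = 1 ∧ ActsBy σ A ∧
      (ω = ω⁻¹ ∨ A 0 1 = 0 ∧ A 1 0 = 0) := by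
  have hω0 : ω ≠ 0 := hω.ne_zero (by omega)
  have hg := star_g hσ
  have hx : σ (x hn hω) * g hn hω = ω • (g hn hω * σ (x hn hω)) := by
    have := congrArg σ (x_mul_g (hn := hn) (hω := hω))
    rw [map_smulₛₗ, hσ.map_mul, hσ.map_mul, hg, conj_root hn hω] at this
    rw [this, smul_smul, mul_inv_cancel₀ hω0, one_smul]
  have hy : σ (y hn hω) * g hn hω = ω⁻¹ • (g hn hω * σ (y hn hω)) := by
    have := congrArg σ (g_mul_y (hn := hn) (hω := hω))
    rwa [map_smulₛₗ, hσ.map_mul, hσ.map_mul, hg, conj_root hn hω] at this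
  obtain ⟨a, b, h1, -, h2⟩ := star_skewPrimitive hσ (hω.ne_one hn) comul_x hx
  obtain ⟨c, d, h3, h4, -⟩ := star_skewPrimitive hσ (hω.inv.ne_one hn) comul_y hy
  have hA : ActsBy σ !![a, b; c, d] := ⟨hg, by simpa using h1, by simpa using h3⟩
  refine ⟨_, (conj_mul_eq_one_iff hA).2 ⟨hσ.involutive _, hσ.involutive _⟩, hA, ?_⟩
  by_cases h : ω = ω⁻¹
  · exact Or.inl h
  · exact Or.inr ⟨by simpa [sub_eq_zero, Ne.symm h] using h2,
      by simpa [sub_eq_zero, h] using h4⟩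

theorem actsBy_unique {A B : Matrix (Fin 2) (Fin 2) ℂ} (hA : ActsBy σ A) (hB : ActsBy σ B) :
    A = B := by
  obtain ⟨h1, h2⟩ := coeff_ext (hA.2.1.symm.trans hB.2.1)
  obtain ⟨h3, h4⟩ := coeff_ext (hA.2.2.symm.trans hB.2.2)
  ext i j
  fin_cases i <;> fin_cases j <;> assumption

end Star

end RadfordAlgebra

/-! ### Constructing conjugate-linear antihomomorphisms -/

/-- The opposite ring of a `ℂ`-algebra, with the conjugate scalar multiplication. -/
def ConjOpposite (A : Type*) : Type _ := Aᵐᵒᵖ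

namespace ConjOpposite

variable {A : Type*} [Ring A]

noncomputable instance : Ring (ConjOpposite A) := inferInstanceAs (Ring Aᵐᵒᵖ)

/-- The identity map `A → ConjOpposite A`. -/
def of (a : A) : ConjOpposite A := MulOpposite.op a

/-- The identity map `ConjOpposite A → A`. -/
def un (a : ConjOpposite A) : A := MulOpposite.unop a

theorem of_mul (a b : A) : of a * of b = of (b * a) := rfl

theorem of_pow (a : A) (k : ℕ) : of a ^ k = of (a ^ k) := (MulOpposite.op_pow a k).symm

theorem of_one : of (1 : A) = 1 := rfl

theorem of_zero : of (0 : A) = 0 := rfl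

theorem un_add (a b : ConjOpposite A) : un (a + b) = un a + un b := rfl

theorem un_mul (a b : ConjOpposite A) : un (a * b) = un b * un a := rfl

variable [Algebra ℂ A]

noncomputable instance : Algebra ℂ (ConjOpposite A) :=
  ((algebraMap ℂ Aᵐᵒᵖ).comp (starRingEnd ℂ)).toAlgebra' fun c a =>
    Algebra.commutes (A := Aᵐᵒᵖ) (starRingEnd ℂ c) a

theorem un_smul (c : ℂ) (a : ConjOpposite A) : un (c • a) = starRingEnd ℂ c • un a := by
  rw [Algebra.smul_def, un_mul, Algebra.smul_def]
  exact (Algebra.commutes _ _).symm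

theorem smul_of (c : ℂ) (a : A) : c • of a = of (starRingEnd ℂ c • a) :=
  congrArg MulOpposite.op (un_smul c (of a))

end ConjOpposite

namespace RadfordAlgebra

variable {n : ℕ} {ω : ℂ} {hn : 1 < n} {hω : IsPrimitiveRoot ω n}

/-- The universal property for conjugate-linear antihomomorphisms. -/
theorem exists_conj_antihom (hconj : starRingEnd ℂ ω = ω⁻¹) {v w : RadfordAlgebra hn hω}
    (hv : v ^ n = 0) (hw : w ^ n = 0)
    (hgv : g hn hω * v = ω⁻¹ • (v * g hn hω)) (hwg : w * g hn hω = ω⁻¹ • (g hn hω * w))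
    (hwv : w * v = ω⁻¹ • (v * w)) :
    ∃ σ : RadfordAlgebra hn hω →ₛₗ[starRingEnd ℂ] RadfordAlgebra hn hω,
      σ 1 = 1 ∧ (∀ a b, σ (a * b) = σ b * σ a) ∧ σ (g hn hω) = g hn hω ∧
        σ (x hn hω) = v ∧ σ (y hn hω) = w := by
  -- A conjugate-linear antihomomorphism is a ℂ-algebra map into the conjugate opposite. There each
  -- defining relation is reversed and `ω` becomes `ω⁻¹`, as in the hypotheses.
  let φ : RadfordAlgebra hn hω →ₐ[ℂ] ConjOpposite (RadfordAlgebra hn hω) :=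
    lift hn hω (.of (g hn hω)) (.of v) (.of w)
      (by rw [ConjOpposite.of_pow, g_pow, ConjOpposite.of_one])
      (by rw [ConjOpposite.of_pow, hv, ConjOpposite.of_zero])
      (by rw [ConjOpposite.of_pow, hw, ConjOpposite.of_zero])
      (by rw [ConjOpposite.of_mul, ConjOpposite.of_mul, ConjOpposite.smul_of, hconj, hgv])
      (by rw [ConjOpposite.of_mul, ConjOpposite.of_mul, ConjOpposite.smul_of, hconj, hwg])
      (by rw [ConjOpposite.of_mul, ConjOpposite.of_mul, ConjOpposite.smul_of, hconj, hwv])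
  refine ⟨{ toFun := fun h => (φ h).un
            map_add' := fun a b => by rw [map_add, ConjOpposite.un_add]
            map_smul' := fun c a => by rw [map_smul, ConjOpposite.un_smul] }, ?_, ?_, ?_, ?_, ?_⟩
  · change (φ 1).un = 1
    rw [_root_.map_one]; rfl
  · intro a b
    change (φ (a * b)).un = (φ b).un * (φ a).un
    rw [map_mul, ConjOpposite.un_mul]
  · exact congrArg ConjOpposite.un lift_g
  · exact congrArg ConjOpposite.un lift_x
  · exact congrArg ConjOpposite.un lift_y

theorem map_map_mul {σ : RadfordAlgebra hn hω →ₛₗ[starRingEnd ℂ] RadfordAlgebra hn hω}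
    (hmul : ∀ a b, σ (a * b) = σ b * σ a)
    (s t : RadfordAlgebra hn hω ⊗[ℂ] RadfordAlgebra hn hω) :
    TensorProduct.map σ σ (s * t) = TensorProduct.map σ σ t * TensorProduct.map σ σ s := by
  induction s with
  | zero => simp
  | add a b ha hb => rw [add_mul, map_add, map_add, ha, hb, mul_add]
  | tmul a b =>
    induction t with
    | zero => simp
    | add c d hc hd => rw [mul_add, map_add, map_add, hc, hd, add_mul]
    | tmul c d =>
      simp only [Algebra.TensorProduct.tmul_mul_tmul, TensorProduct.map_tmul, hmul]

/-- Antimultiplicativity makes the value inverse to `S(g) = g^(n-1)`. -/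
theorem antipodeLin_g_pow : antipodeLin hn hω (g hn hω ^ (n - 1)) = g hn hω := by
  have h := antipodeLin_mul (g hn hω) (g hn hω ^ (n - 1))
  rw [g_mul_g_pow, antipodeLin_one, antipodeLin_g] at h
  calc _ = antipodeLin hn hω (g hn hω ^ (n - 1)) * (g hn hω ^ (n - 1) * g hn hω) := by
        rw [g_pow_mul_g, mul_one]
    _ = _ := by rw [← mul_assoc, ← h, one_mul]

/-- A conjugate-linear antihomomorphism that fixes `g` and restricts to an involution of
`ℂ x + ℂ y` is a `*`-structure. -/
theorem isHopfStarStructure_of_generators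
    {σ : RadfordAlgebra hn hω →ₛₗ[starRingEnd ℂ] RadfordAlgebra hn hω}
    (hone : σ 1 = 1) (hmul : ∀ a b, σ (a * b) = σ b * σ a) (hg : σ (g hn hω) = g hn hω)
    {a b c d : ℂ} (hx : σ (x hn hω) = a • x hn hω + b • y hn hω)
    (hy : σ (y hn hω) = c • x hn hω + d • y hn hω) (hxx : σ (σ (x hn hω)) = x hn hω)
    (hyy : σ (σ (y hn hω)) = y hn hω) : IsHopfStarStructure σ := by
  have hgpow : ∀ k, σ (g hn hω ^ k) = g hn hω ^ k := by
    intro k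
    induction k with
    | zero => simpa using hone
    | succ k ih => rw [pow_succ, hmul, ih, hg, ← pow_succ', pow_succ]
  have hS : ∀ a b : ℂ, antipodeLin hn hω (a • x hn hω + b • y hn hω) =
      -((a • x hn hω + b • y hn hω) * g hn hω ^ (n - 1)) := by
    intro a b
    rw [map_add, map_smul, map_smul, antipodeLin_x, antipodeLin_y, add_mul, smul_mul_assoc,
      smul_mul_assoc]
    module
  have hΔ : ∀ a b : ℂ, Coalgebra.comul (R := ℂ) (a • x hn hω + b • y hn hω) =
      (a • x hn hω + b • y hn hω) ⊗ₜ g hn hω + 1 ⊗ₜ (a • x hn hω + b • y hn hω) := by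
    intro a b
    rw [map_add, map_smul, map_smul, comul_x, comul_y, TensorProduct.add_tmul,
      TensorProduct.tmul_add, TensorProduct.tmul_smul, TensorProduct.tmul_smul,
      ← TensorProduct.smul_tmul', ← TensorProduct.smul_tmul']
    module
  -- With `g^(n-1)` written as `g⁻¹`: `S` sends `σ z` to `-(σ z) g⁻¹`, `σ` sends that to `-g⁻¹ z`,
  -- and `S` sends this to `z g⁻¹ g = z`.
  have hanti : ∀ z : RadfordAlgebra hn hω, σ (σ z) = z →
      antipodeLin hn hω z = -(z * g hn hω ^ (n - 1)) →
      antipodeLin hn hω (σ z) = -(σ z * g hn hω ^ (n - 1)) →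
      antipodeLin hn hω (σ (antipodeLin hn hω (σ z))) = z := by
    intro z h1 h2 h3
    rw [h3, map_neg, hmul, hgpow, h1, map_neg, antipodeLin_mul, h2, antipodeLin_g_pow, neg_mul,
      neg_neg, mul_assoc, g_pow_mul_g, mul_one]
  refine ⟨fun h => ?_, hmul, fun h => ?_, fun h => ?_⟩
  · induction h using RadfordAlgebra.induction with
    | halg r =>
      simp [Algebra.algebraMap_eq_smul_one, hone]
    | hg => rw [hg, hg]
    | hx => exact hxx
    | hy => exact hyy
    | hmul a b ha hb => rw [hmul, hmul, ha, hb]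
    | hadd a b ha hb => rw [map_add, map_add, ha, hb]
  · induction h using RadfordAlgebra.induction with
    | halg r =>
      simp [Algebra.algebraMap_eq_smul_one, hone, Algebra.TensorProduct.one_def]
    | hg => rw [hg, comul_g, TensorProduct.map_tmul, hg]
    | hx => rw [comul_x, map_add, TensorProduct.map_tmul, TensorProduct.map_tmul, hone, hg, hx, hΔ]
    | hy => rw [comul_y, map_add, TensorProduct.map_tmul, TensorProduct.map_tmul, hone, hg, hy, hΔ]
    | hmul a b ha hb =>
      rw [hmul, Bialgebra.comul_mul, Bialgebra.comul_mul, map_map_mul hmul, ha, hb]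
    | hadd a b ha hb => simp only [map_add, ha, hb]
  · change antipodeLin hn hω (σ (antipodeLin hn hω (σ h))) = h
    induction h using RadfordAlgebra.induction with
    | halg r =>
      simp [Algebra.algebraMap_eq_smul_one, hone, antipodeLin_one]
    | hg => rw [hg, antipodeLin_g, hgpow, antipodeLin_g_pow]
    | hx => exact hanti _ hxx antipodeLin_x (by rw [hx, hS])
    | hy => exact hanti _ hyy antipodeLin_y (by rw [hy, hS])
    | hmul a b ha hb => rw [hmul, antipodeLin_mul, hmul, antipodeLin_mul, ha, hb]
    | hadd a b ha hb => simp only [map_add, ha, hb]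

/-- If `ω = ω⁻¹`, then `y x = ω x y` and the `q`-binomial theorem at a primitive root leaves only
`n`-th powers. Otherwise a single term is present. -/
theorem smul_add_smul_pow_eq_zero {a b : ℂ} (h : ω = ω⁻¹ ∨ a = 0 ∨ b = 0) :
    (a • x hn hω + b • y hn hω) ^ n = 0 := by
  rcases h with h | rfl | rfl
  · rw [add_pow_of_qcomm_primitive hn hω, smul_pow, smul_pow, x_pow, y_pow]
    · simp
    · rw [smul_mul_smul_comm, smul_mul_smul_comm, y_mul_x, ← h, mul_comm a b, smul_comm]
  · rw [zero_smul, zero_add, smul_pow, y_pow, smul_zero]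
  · rw [zero_smul, add_zero, smul_pow, x_pow, smul_zero]

theorem eq_two_of_eq_inv (hn : 1 < n) (hω : IsPrimitiveRoot ω n) (h : ω = ω⁻¹) : n = 2 := by
  have h1 : ω ^ 2 = 1 := by
    rw [pow_two]
    nth_rewrite 2 [h]
    exact mul_inv_cancel₀ (hω.ne_zero (by omega))
  have := Nat.le_of_dvd (by omega) (hω.dvd_of_pow_eq_one 2 h1)
  omega

theorem exists_conj_antihom_of_matrix (hconj : starRingEnd ℂ ω = ω⁻¹) {a b c d : ℂ}
    (h : ω = ω⁻¹ ∨ b = 0 ∧ c = 0) :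
    ∃ σ : RadfordAlgebra hn hω →ₛₗ[starRingEnd ℂ] RadfordAlgebra hn hω,
      σ 1 = 1 ∧ (∀ a b, σ (a * b) = σ b * σ a) ∧ σ (g hn hω) = g hn hω ∧
        σ (x hn hω) = a • x hn hω + b • y hn hω ∧ σ (y hn hω) = c • x hn hω + d • y hn hω := by
  apply exists_conj_antihom hconj
  · exact smul_add_smul_pow_eq_zero (by tauto)
  · exact smul_add_smul_pow_eq_zero (by tauto)
  · rcases h with h | ⟨rfl, rfl⟩
    · simp only [mul_add, add_mul, mul_smul_comm, smul_mul_assoc, g_mul_x, g_mul_y, ← h]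
      module
    · simp only [zero_smul, add_zero, mul_smul_comm, smul_mul_assoc, g_mul_x]
      module
  · rcases h with h | ⟨rfl, rfl⟩
    · simp only [mul_add, add_mul, mul_smul_comm, smul_mul_assoc, x_mul_g, y_mul_g, ← h]
      module
    · simp only [zero_smul, zero_add, mul_smul_comm, smul_mul_assoc, y_mul_g]
      module
  · rcases h with h | ⟨rfl, rfl⟩
    · obtain rfl := eq_two_of_eq_inv hn hω h
      have hxx : x hn hω * x hn hω = 0 := by rw [← pow_two, x_pow]
      have hyy : y hn hω * y hn hω = 0 := by rw [← pow_two, y_pow]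
      have hωω : ω * ω = 1 := by rw [← pow_two, hω.pow_eq_one]
      -- The squares vanish because `n = 2`, so both sides are multiples of `x y`. The `a d` terms
      -- agree and the `b c` terms differ by the factor `ω²`.
      simp only [mul_add, add_mul, mul_smul_comm, smul_mul_assoc, hxx, hyy, y_mul_x, ← h,
        smul_zero, smul_add, smul_smul]
      match_scalars
      linear_combination (-c * b) * hωω
    · simp only [zero_smul, add_zero, zero_add, mul_smul_comm, smul_mul_assoc, y_mul_x]
      module

end RadfordAlgebra

/-! ### Assembling the two cases -/

namespace RadfordAlgebra

variable {n : ℕ} {ω : ℂ} {hn : 1 < n} {hω : IsPrimitiveRoot ω n}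

/-- The alternative on `ω` and `A` is the one produced by `exists_actsBy`, so a single statement
serves all `n`: diagonal matrices for `n > 2`, arbitrary ones for `n = 2`. -/
theorem existsUnique_star_actsBy (A : Matrix (Fin 2) (Fin 2) ℂ)
    (hA : A.map (starRingEnd ℂ) * A = 1) (h : ω = ω⁻¹ ∨ A 0 1 = 0 ∧ A 1 0 = 0) :
    ∃! σ : RadfordAlgebra hn hω →ₛₗ[starRingEnd ℂ] RadfordAlgebra hn hω,
      IsHopfStarStructure σ ∧ ActsBy σ A := by
  obtain ⟨σ, hone, hmul, hact⟩ := exists_conj_antihom_of_matrix (hn := hn) (hω := hω)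
    (a := A 0 0) (d := A 1 1) (conj_root hn hω) h
  obtain ⟨hxx, hyy⟩ := (conj_mul_eq_one_iff hact).1 hA
  refine ⟨σ, ⟨isHopfStarStructure_of_generators hone hmul hact.1 hact.2.1 hact.2.2 hxx hyy,
    hact⟩, ?_⟩
  rintro τ ⟨hτ, hτact⟩
  exact star_ext hτ (isHopfStarStructure_of_generators hone hmul hact.1 hact.2.1 hact.2.2 hxx hyy)
    (hτact.1.trans hact.1.symm) (hτact.2.1.trans hact.2.1.symm) (hτact.2.2.trans hact.2.2.symm)

theorem actsBy_diagonal_iff {σ : RadfordAlgebra hn hω →ₛₗ[starRingEnd ℂ] RadfordAlgebra hn hω}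
    {α β : ℂ} : ActsBy σ !![α, 0; 0, β] ↔
      σ (g hn hω) = g hn hω ∧ σ (x hn hω) = α • x hn hω ∧ σ (y hn hω) = β • y hn hω := by
  simp [ActsBy]

theorem conj_mul_eq_one_iff_norm (α : ℂ) : starRingEnd ℂ α * α = 1 ↔ ‖α‖ = 1 := by
  rw [Complex.conj_mul', ← Complex.ofReal_pow, Complex.ofReal_eq_one,
    pow_eq_one_iff_of_nonneg (norm_nonneg α) two_ne_zero]

theorem diagonal_conj_mul_eq_one_iff {α β : ℂ} :
    (!![α, 0; 0, β] : Matrix (Fin 2) (Fin 2) ℂ).map (starRingEnd ℂ) * !![α, 0; 0, β] = 1 ↔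
      ‖α‖ = 1 ∧ ‖β‖ = 1 := by
  rw [← conj_mul_eq_one_iff_norm, ← conj_mul_eq_one_iff_norm, ← Matrix.ext_iff]
  simp [Fin.forall_fin_two, Matrix.mul_apply]

end RadfordAlgebra

open RadfordAlgebra in
theorem theorem3p7 {n : ℕ} {ω : ℂ} (hn : 1 < n) (hω : IsPrimitiveRoot ω n) :
    (2 < n →
      (∀ α β : ℂ, ‖α‖ = 1 → ‖β‖ = 1 →
        ∃! σ : RadfordAlgebra hn hω →ₛₗ[starRingEnd ℂ] RadfordAlgebra hn hω,
          IsHopfStarStructure σ ∧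
            σ (RadfordAlgebra.g hn hω) = RadfordAlgebra.g hn hω ∧
            σ (RadfordAlgebra.x hn hω) = α • RadfordAlgebra.x hn hω ∧
            σ (RadfordAlgebra.y hn hω) = β • RadfordAlgebra.y hn hω) ∧
      (∀ σ : RadfordAlgebra hn hω →ₛₗ[starRingEnd ℂ] RadfordAlgebra hn hω,
        IsHopfStarStructure σ →
          ∃! p : ℂ × ℂ, ‖p.1‖ = 1 ∧ ‖p.2‖ = 1 ∧
            σ (RadfordAlgebra.g hn hω) = RadfordAlgebra.g hn hω ∧
            σ (RadfordAlgebra.x hn hω) = p.1 • RadfordAlgebra.x hn hω ∧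
            σ (RadfordAlgebra.y hn hω) = p.2 • RadfordAlgebra.y hn hω)) ∧
    (n = 2 →
      (∀ A : Matrix (Fin 2) (Fin 2) ℂ, A.map (starRingEnd ℂ) * A = 1 →
        ∃! σ : RadfordAlgebra hn hω →ₛₗ[starRingEnd ℂ] RadfordAlgebra hn hω,
          IsHopfStarStructure σ ∧
            σ (RadfordAlgebra.g hn hω) = RadfordAlgebra.g hn hω ∧
            σ (RadfordAlgebra.x hn hω) =
              A 0 0 • RadfordAlgebra.x hn hω + A 0 1 • RadfordAlgebra.y hn hω ∧
            σ (RadfordAlgebra.y hn hω) =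
              A 1 0 • RadfordAlgebra.x hn hω + A 1 1 • RadfordAlgebra.y hn hω) ∧
      (∀ σ : RadfordAlgebra hn hω →ₛₗ[starRingEnd ℂ] RadfordAlgebra hn hω,
        IsHopfStarStructure σ →
          ∃! A : Matrix (Fin 2) (Fin 2) ℂ, A.map (starRingEnd ℂ) * A = 1 ∧
            σ (RadfordAlgebra.g hn hω) = RadfordAlgebra.g hn hω ∧
            σ (RadfordAlgebra.x hn hω) =
              A 0 0 • RadfordAlgebra.x hn hω + A 0 1 • RadfordAlgebra.y hn hω ∧
            σ (RadfordAlgebra.y hn hω) =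
              A 1 0 • RadfordAlgebra.x hn hω + A 1 1 • RadfordAlgebra.y hn hω)) := by
  refine ⟨fun h2 => ⟨fun α β hα hβ => ?_, fun σ hσ => ?_⟩,
    fun h2 => ⟨fun A hA => ?_, fun σ hσ => ?_⟩⟩
  · simpa only [actsBy_diagonal_iff] using existsUnique_star_actsBy (hn := hn) (hω := hω)
      !![α, 0; 0, β] (diagonal_conj_mul_eq_one_iff.2 ⟨hα, hβ⟩) (Or.inr ⟨rfl, rfl⟩)
  · obtain ⟨A, hA, hact, h⟩ := exists_actsBy hσ
    obtain ⟨h01, h10⟩ := h.resolve_left fun h => h2.ne' (eq_two_of_eq_inv hn hω h)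
    have hdiag : A = !![A 0 0, 0; 0, A 1 1] := by
      conv_lhs => rw [Matrix.eta_fin_two A, h01, h10]
    rw [hdiag] at hA hact
    obtain ⟨h0, h1⟩ := diagonal_conj_mul_eq_one_iff.1 hA
    refine ⟨(A 0 0, A 1 1), ⟨h0, h1, actsBy_diagonal_iff.1 hact⟩, ?_⟩
    rintro ⟨α, β⟩ ⟨-, -, hp⟩
    have := actsBy_unique (actsBy_diagonal_iff.2 hp) hact
    exact Prod.ext (congrFun (congrFun this 0) 0) (congrFun (congrFun this 1) 1)
  · refine existsUnique_star_actsBy A hA (Or.inl ?_)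
    subst h2
    exact eq_inv_of_mul_eq_one_left (by rw [← pow_two, hω.pow_eq_one])
  · obtain ⟨A, hA, hact, -⟩ := exists_actsBy hσ
    exact ⟨A, ⟨hA, hact⟩, fun B hB => actsBy_unique hB.2 hact⟩
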